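/- Let $\mathcal H\neq\{0\}$ be a complex Hilbert space and $B_c$ a bounded linear operator on $\mathcal H$ with Hermitian part $B_H=\frac12(B_c+B_c^*)\ge 0$ (i.e. $-B_c$ is semi-dissipative). Assume that $B_c$ has hypocoercivity index (HC-index) $m\in\mathbb N_0$, i.e. $m$ is the smallest $n\in\mathbb{N}_0$ such that $\sum_{j=0}^n (B_c^*)^jB_HB_c^j\ge\kappa I$ for some $\kappa>0$. Put $\Phi(t)=\|e^{-B_ct}\|$ for $t\ge0$, and for $\tau>0$ let $$B_d(\tau)=M_\tau(-B_c)=\left(I+\tfrac\tau2B_c\right)^{-1}\left(I-\tfrac\tau2B_c\right)$$ be the scaled Cayley transform (implicit midpoint rule); it is well defined for every $\tau>0$. Let $\phi_k(\tau)=\|B_d(\tau)^k\|$ for $k\in\mathbb N_0$ and $\phi_{k}(\tau)=2-\phi_{-k}(\tau)$ for integers $k<0$. For a function $f$ on $\mathbb Z$ let $[\Delta^nf]_{k=0}$ denote its symmetric finite difference of order $n$ at $k=0$, namely $$[\Delta^{2r}f]_{k=0}=\sum_{i=0}^{2r}(-1)^i\tbinom{2r}{i}f_{r-i},\qquad [\Delta^{2r+1}f]_{k=0}=\tfrac12\sum_{i=0}^{2r+1}(-1)^i\tbinom{2r+1}{i}\left(f_{r+1-i}+f_{r-i}\right).$$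 For a real function $F$ on $[0,\infty)$, the $n$-th (one-sided) Peano derivative at $0$ is the number $F_{(n)}(0)=q_n$ if $F(t)=\sum_{j=0}^n\frac{q_j}{j!}t^j+o(t^n)$ as $t\to0+$ with real $q_0=F(0),q_1,\dots,q_n$. Then the limit $$c=\frac1{(2m+1)!\binom{2m}{m}}\lim_{\delta\to0+}\ \inf\left\{\left\|\sqrt{B_H}B_c^my\right\|^2:\ \|y\|=1,\ \left\|\sqrt{B_H}B_c^py\right\|\le\delta\text{ for }0\le p<m\right\}$$ exists, $c>0$, and, with this constant of the continuous-time expansion $$\|e^{-B_ct}\|=1-c\,t^{2m+1}+o(t^{2m+1})\qquad(t\to0+),$$ one has $$\|B_d(\tau)^{m+1}\|=1-(2m+1)!\,c\,\tau^{2m+1}+o(\tau^{2m+1})\qquad(\tau\to0+).$$ Moreover, $[\Delta^{2m+1}\phi(\tau)]_{k=0}=\phi_{m+1}(\tau)-1$ for all $\tau>0$, the Peano derivative $\Phi_{(2m+1)}(0)$ exists, and $$\frac{[\Delta^{2m+1}\phi(\tau)]_{k=0}}{\tau^{2m+1}}\longrightarrow\Phi_{(2m+1)}(0)=-(2m+1)!\,c\qquad(\tau\to0+).$$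 Finally, for every $j=0,\dots,2m$ the Peano derivative $\Phi_{(j)}(0)$ exists and, for all $\tau>0$, $$[\Delta^j\phi(\tau)]_{k=0}=\Phi_{(j)}(0)=\delta_0^j,$$ where $\delta_0^j=1$ if $j=0$ and $\delta_0^j=0$ otherwise. -/

import Mathlib

open Filter Topology Asymptotics

noncomputable section

namespace Hypocoercivity

variable {H : Type*} [NormedAddCommGroup H] [InnerProductSpace ℂ H] [CompleteSpace H]

/-- The Hermitian part `B_H = (B + B*) / 2` of a bounded operator `B`. -/
def hermPart (B : H →L[ℂ] H) : H →L[ℂ] H :=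
  (1 / 2 : ℝ) • (B + ContinuousLinearMap.adjoint B)

/-- `A` is semi-dissipative: the Hermitian part of `-A` is positive semidefinite. -/
def IsSemiDissipative (A : H →L[ℂ] H) : Prop :=
  (hermPart (-A)).IsPositive

/-- The coercivity condition `∑_{j=0}^m (B*)^j B_H B^j ≥ κ I` for some `κ > 0`
(with the Loewner order of operators). -/
def HCCondition (B : H →L[ℂ] H) (m : ℕ) : Prop :=
  ∃ κ : ℝ, 0 < κ ∧
    κ • (1 : H →L[ℂ] H) ≤
      ∑ j ∈ Finset.range (m + 1), (ContinuousLinearMap.adjoint B) ^ j * hermPart B * B ^ j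

/-- `m` is the hypocoercivity index (HC-index) of `B`: the smallest `m` for which the coercivity
condition holds. -/
def IsHCIndex (B : H →L[ℂ] H) (m : ℕ) : Prop :=
  IsLeast {n : ℕ | HCCondition B n} m

/-- The infimum of `‖√B_H B^m y‖²` over all unit vectors `y` with
`‖√B_H B^p y‖ ≤ δ` for `0 ≤ p < m`. -/
def constrainedInf (B : H →L[ℂ] H) (m : ℕ) (δ : ℝ) : ℝ :=
  sInf ((fun y : H => ‖CFC.sqrt (hermPart B) ((B ^ m) y)‖ ^ 2) ''
    {y : H | ‖y‖ = 1 ∧ ∀ p < m, ‖CFC.sqrt (hermPart B) ((B ^ p) y)‖ ≤ δ})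

/-- The propagator norm `Φ(t) = ‖exp(-t B)‖`. -/
def propagatorNorm (B : H →L[ℂ] H) (t : ℝ) : ℝ :=
  ‖NormedSpace.exp (-(t • B))‖

/-- The scaled Cayley transform `M_τ(A) = (1 - (τ/2) A)⁻¹ (1 + (τ/2) A)`; it is well defined
exactly when `1 - (τ/2) A` is invertible. -/
def scaledCayley (τ : ℝ) (A : H →L[ℂ] H) : H →L[ℂ] H :=
  Ring.inverse (1 - (τ / 2) • A) * (1 + (τ / 2) • A)

/-- The grid function `φ_k(τ) = ‖B_d(τ)^k‖` for `k ≥ 0`, where `B_d(τ) = M_τ(-B)`, extended to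
negative `k` by odd symmetry about `(0, 1)`: `φ_k(τ) = 2 - φ_{-k}(τ)`. -/
def gridNorm (B : H →L[ℂ] H) (τ : ℝ) (k : ℤ) : ℝ :=
  if 0 ≤ k then ‖scaledCayley τ (-B) ^ k.natAbs‖ else 2 - ‖scaledCayley τ (-B) ^ k.natAbs‖

/-- The symmetric (central) finite difference of order `n` of `f : ℤ → ℝ` at the index `k`.
For even `n = 2r` it is the usual central difference `∑ i, (-1)^i (n choose i) f (k + r - i)`;
for odd `n = 2r + 1` it is the mean of the two one-step shifted differences
`∑ i, (-1)^i (n choose i) f (k + r + 1 - i)` and `∑ i, (-1)^i (n choose i) f (k + r - i)`.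
The coefficients are thus `-1/2, 0, 1/2` for `n = 1`, `1, -2, 1` for `n = 2`,
`-1/2, 1, 0, -1, 1/2` for `n = 3`, and so on. -/
def centralDiff (n : ℕ) (f : ℤ → ℝ) (k : ℤ) : ℝ :=
  (1 / 2) * ∑ i ∈ Finset.range (n + 1), (-1 : ℝ) ^ i * (n.choose i : ℝ) *
    (f (k + (((n + 1) / 2 : ℕ) : ℤ) - (i : ℤ)) + f (k + ((n / 2 : ℕ) : ℤ) - (i : ℤ)))

/-- `f` is `n` times (one-sidedly, from the right) Peano differentiable at `x`, and `a` is its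
`n`-th Peano derivative `f_(n)(x)`: there are numbers `q 0 = f x, q 1, …, q n = a` with
`f (x + t) = ∑_{j=0}^n q j / j! * t^j + o(t^n)` as `t → 0+`. -/
def HasPeanoDeriv (n : ℕ) (f : ℝ → ℝ) (x a : ℝ) : Prop :=
  ∃ q : ℕ → ℝ, q 0 = f x ∧ q n = a ∧
    (fun t : ℝ => f (x + t) - ∑ j ∈ Finset.range (n + 1), q j / (j.factorial : ℝ) * t ^ j)
      =o[𝓝[>] 0] fun t : ℝ => t ^ n

end Hypocoercivity

end

open Hypocoercivity

noncomputable section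

namespace Hypocoercivity

set_option linter.unusedSectionVars false

variable {H : Type*} [NormedAddCommGroup H] [InnerProductSpace ℂ H] [CompleteSpace H]

/-! Write `S = √B_H` and let `c₀` be the limit of the constrained infimum. Both the propagator and
the Cayley power obey an energy balance `‖T(Ky)‖² = ‖Ky‖² - 2t ∫ ‖S F(t,σ) y‖² dμ(σ)` with `K = 1 +
O(t)` and `F(t,σ) = ∑_{q≤m} t^q a_q(σ) B^q + O(t^(m+1))`. For the exponential, `σ` runs over
`[0,1]`, `K = 1` and `a_q = (-σ)^q/q!`. For the Cayley power, `σ = j` runs over `m + 1` points with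
counting measure, `K = (1 + τB/2)^(m+1)`, and `a_q(j)` are the coefficients of `(1 + X/2)^(m-j) (1 -
X/2)^j`.

Minimal dissipation is `t^(2m) l c₀` to leading order, where `l` is the squared `L²(μ)` distance of
`a_m` from the span of `a_q`, `q < m` (`norm_sub_isLittleO`). Let `h_p` be orthogonal to `a_q` for
`q < p`, with `⟨h_p, a_p⟩ = 1`. From below, averaging `S F y` against `h_p` isolates `t^p S B^p y`;
small dissipation therefore forces `S B^p y = O(t)` for `p < m`, and `p = m` gives the bound with `l
= 1/‖h_m‖²`. From above, a nearly optimal `y` is corrected by multiples of `t^i B^i y` so that `a_m`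
is replaced by its residual `l h_m`.

What differs is only `‖h_m‖²`: normalised shifted Legendre polynomials give `(2m+1)! (2m choose m)`,
signed binomial weights give `(2m choose m)`. Their ratio is the factor `(2m+1)!`.

Finally, `k ≤ m` steps of the midpoint rule lose energy only through polynomials in `B` of degree
below `m`, so nearly conservative vectors show that the norm is exactly one
(`norm_scaledCayley_pow_eq_one`). Central differences then see only the grid values at `±(m+1)`. -/

/-! ### Quadratic form of the Hermitian part -/

lemma hermPart_nonneg {B : H →L[ℂ] H} (hB : IsSemiDissipative (-B)) : 0 ≤ hermPart B := by
  rw [ContinuousLinearMap.nonneg_iff_isPositive]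
  simpa [IsSemiDissipative] using hB

lemma re_inner_hermPart (B : H →L[ℂ] H) (x : H) :
    (inner ℂ (hermPart B x) x).re = (inner ℂ (B x) x).re := by
  have h : inner ℂ (hermPart B x) x
      = ((1 / 2 : ℝ) : ℂ) * (inner ℂ (B x) x + inner ℂ x (B x)) := by
    simp only [hermPart, smul_apply, add_apply,
      inner_smul_left_eq_smul, inner_add_left, ContinuousLinearMap.adjoint_inner_left,
      Complex.real_smul]
  rw [h, Complex.re_ofReal_mul, Complex.add_re, ← inner_conj_symm x (B x), Complex.conj_re]
  ring

lemma norm_sqrt_hermPart_sq {B : H →L[ℂ] H} (hB : IsSemiDissipative (-B)) (x : H) :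
    ‖CFC.sqrt (hermPart B) x‖ ^ 2 = (inner ℂ (hermPart B x) x).re := by
  have hsa : IsSelfAdjoint (CFC.sqrt (hermPart B)) :=
    (CFC.sqrt_nonneg (hermPart B)).isSelfAdjoint
  have hmul := CFC.sqrt_mul_sqrt_self (hermPart B) (hermPart_nonneg hB)
  rw [← inner_self_eq_norm_sq (𝕜 := ℂ)]
  conv_rhs => rw [← hmul]
  rw [mul_apply_eq_comp, ← ContinuousLinearMap.adjoint_inner_left, hsa.adjoint_eq]
  rfl

lemma re_inner_self_eq {B : H →L[ℂ] H} (hB : IsSemiDissipative (-B)) (x : H) :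
    (inner ℂ (B x) x).re = ‖CFC.sqrt (hermPart B) x‖ ^ 2 := by
  rw [norm_sqrt_hermPart_sq hB, re_inner_hermPart]

lemma adjoint_pow_apply_inner (B : H →L[ℂ] H) (j : ℕ) (x y : H) :
    inner ℂ (((ContinuousLinearMap.adjoint B) ^ j) x) y = inner ℂ x ((B ^ j) y) := by
  rw [← ContinuousLinearMap.star_eq_adjoint, ← star_pow, ContinuousLinearMap.star_eq_adjoint,
    ContinuousLinearMap.adjoint_inner_left]

/-- Both sides of the Loewner inequality are self-adjoint, so it can be tested on quadratic forms,
where each summand becomes a squared norm. -/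
lemma hcCondition_iff {B : H →L[ℂ] H} (hB : IsSemiDissipative (-B)) (n : ℕ) :
    HCCondition B n ↔ ∃ κ : ℝ, 0 < κ ∧ ∀ y : H, κ * ‖y‖ ^ 2 ≤
      ∑ j ∈ Finset.range (n + 1), ‖CFC.sqrt (hermPart B) ((B ^ j) y)‖ ^ 2 := by
  unfold HCCondition
  refine exists_congr fun κ => and_congr_right fun _ => ?_
  have hH : ∀ j, IsSelfAdjoint ((ContinuousLinearMap.adjoint B) ^ j * hermPart B * B ^ j) := by
    intro j
    have := (hermPart_nonneg hB).isSelfAdjoint.conjugate (star (B ^ j))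
    rwa [star_star, star_pow, ContinuousLinearMap.star_eq_adjoint] at this
  have hS : IsSelfAdjoint (∑ j ∈ Finset.range (n + 1),
      (ContinuousLinearMap.adjoint B) ^ j * hermPart B * B ^ j - κ • (1 : H →L[ℂ] H)) := by
    refine IsSelfAdjoint.sub ?_ ?_
    · exact isSelfAdjoint_sum _ fun j _ => hH j
    · exact (IsSelfAdjoint.all κ).smul (IsSelfAdjoint.one _)
  rw [ContinuousLinearMap.le_def, ContinuousLinearMap.isPositive_def']
  rw [and_iff_right hS]
  refine forall_congr' fun y => ?_
  rw [ContinuousLinearMap.reApplyInnerSelf_apply, sub_apply, inner_sub_left,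
    map_sub, sub_nonneg]
  have h1 : RCLike.re (inner ℂ ((κ • (1 : H →L[ℂ] H)) y) y) = κ * ‖y‖ ^ 2 := by
    rw [smul_apply, inner_smul_left_eq_smul, one_apply_eq_self,
      Complex.real_smul]
    simp only [RCLike.re_to_complex]
    rw [Complex.re_ofReal_mul]
    congr 1
    exact inner_self_eq_norm_sq (𝕜 := ℂ) y
  have h2 : RCLike.re (inner ℂ ((∑ j ∈ Finset.range (n + 1),
      (ContinuousLinearMap.adjoint B) ^ j * hermPart B * B ^ j) y) y) =
      ∑ j ∈ Finset.range (n + 1), ‖CFC.sqrt (hermPart B) ((B ^ j) y)‖ ^ 2 := by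
    rw [sum_apply, sum_inner, map_sum]
    refine Finset.sum_congr rfl fun j _ => ?_
    rw [norm_sqrt_hermPart_sq hB, mul_apply_eq_comp, mul_apply_eq_comp,
      adjoint_pow_apply_inner]
    rfl
  rw [h1, h2]

/-! ### Nearly conservative vectors and the constrained infimum -/

/-- The vectors that are nearly annihilated by `√B_H B^p` for all `p < m` exist for every
tolerance if no coercivity condition of order below `m` holds. -/
lemma exists_nearly_conservative [Nontrivial H] {B : H →L[ℂ] H} (hB : IsSemiDissipative (-B))
    {m : ℕ} (hm : IsHCIndex B m) {δ : ℝ} (hδ : 0 < δ) :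
    ∃ y : H, ‖y‖ = 1 ∧ ∀ p < m, ‖CFC.sqrt (hermPart B) ((B ^ p) y)‖ ≤ δ := by
  rcases Nat.eq_zero_or_pos m with rfl | hpos
  · obtain ⟨y, hy⟩ := exists_norm_eq H zero_le_one
    exact ⟨y, hy, fun p hp => absurd hp (Nat.not_lt_zero p)⟩
  -- Minimality of `m` makes coercivity fail at `m - 1` for every constant, in particular for `δ ^
  -- 2`; normalising the witness gives `y`.
  · have hn : ¬ HCCondition B (m - 1) := fun h => by
      have := hm.2 h
      omega
    rw [hcCondition_iff hB] at hn
    push Not at hn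
    obtain ⟨y, hy⟩ := hn (δ ^ 2) (by positivity)
    rw [Nat.sub_add_cancel hpos] at hy
    have hy0 : y ≠ 0 := by
      rintro rfl
      simp at hy
    have hny : 0 < ‖y‖ := norm_pos_iff.2 hy0
    refine ⟨((‖y‖⁻¹ : ℝ) : ℂ) • y, ?_, fun p hp => ?_⟩
    · rw [norm_smul, Complex.norm_real, Real.norm_of_nonneg (by positivity),
        inv_mul_cancel₀ hny.ne']
    · rw [map_smul, map_smul, norm_smul, Complex.norm_real, Real.norm_of_nonneg (by positivity),
        inv_mul_le_iff₀ hny, mul_comm]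
      refine (pow_le_pow_iff_left₀ (by positivity) (by positivity) two_ne_zero).1 ?_
      calc ‖CFC.sqrt (hermPart B) ((B ^ p) y)‖ ^ 2
          ≤ ∑ j ∈ Finset.range m, ‖CFC.sqrt (hermPart B) ((B ^ j) y)‖ ^ 2 :=
            Finset.single_le_sum (f := fun j => ‖CFC.sqrt (hermPart B) ((B ^ j) y)‖ ^ 2)
              (fun _ _ => by positivity) (Finset.mem_range.2 hp)
        _ ≤ (δ * ‖y‖) ^ 2 := by rw [mul_pow]; exact hy.le

lemma bddBelow_constrained (B : H →L[ℂ] H) (m : ℕ) (s : Set H) :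
    BddBelow ((fun y : H => ‖CFC.sqrt (hermPart B) ((B ^ m) y)‖ ^ 2) '' s) :=
  ⟨0, by rintro _ ⟨y, -, rfl⟩; positivity⟩

lemma constrainedInf_le (B : H →L[ℂ] H) (m : ℕ) {δ : ℝ} {y : H} (hy : ‖y‖ = 1)
    (h : ∀ p < m, ‖CFC.sqrt (hermPart B) ((B ^ p) y)‖ ≤ δ) :
    constrainedInf B m δ ≤ ‖CFC.sqrt (hermPart B) ((B ^ m) y)‖ ^ 2 :=
  csInf_le (bddBelow_constrained B m _) ⟨y, ⟨hy, h⟩, rfl⟩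

lemma exists_lt_constrainedInf_add [Nontrivial H] {B : H →L[ℂ] H} (hB : IsSemiDissipative (-B))
    {m : ℕ} (hm : IsHCIndex B m) {δ ε : ℝ} (hδ : 0 < δ) (hε : 0 < ε) :
    ∃ y : H, ‖y‖ = 1 ∧ (∀ p < m, ‖CFC.sqrt (hermPart B) ((B ^ p) y)‖ ≤ δ) ∧
      ‖CFC.sqrt (hermPart B) ((B ^ m) y)‖ ^ 2 < constrainedInf B m δ + ε := by
  obtain ⟨y₀, hy₀⟩ := exists_nearly_conservative hB hm hδ
  obtain ⟨_, ⟨y, hy, rfl⟩, hlt⟩ := exists_lt_of_csInf_lt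
    (Set.Nonempty.image (fun y : H => ‖CFC.sqrt (hermPart B) ((B ^ m) y)‖ ^ 2) ⟨y₀, hy₀⟩)
    (lt_add_of_pos_right (constrainedInf B m δ) hε)
  exact ⟨y, hy.1, hy.2, hlt⟩

/-- The constrained infimum converges to a positive number as the tolerance tends to zero. -/
lemma exists_tendsto_constrainedInf [Nontrivial H] {B : H →L[ℂ] H}
    (hB : IsSemiDissipative (-B)) {m : ℕ} (hm : IsHCIndex B m) :
    ∃ c₀ : ℝ, 0 < c₀ ∧ Tendsto (constrainedInf B m) (𝓝[>] 0) (𝓝 c₀) := by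
  -- A smaller tolerance leaves fewer competitors, so the infimum grows as `δ` decreases and its
  -- limit at `0+` is its supremum.
  have hanti : AntitoneOn (constrainedInf B m) (Set.Ioi 0) := by
    intro a ha b _ hab
    obtain ⟨y₀, hy₀⟩ := exists_nearly_conservative hB hm ha
    exact csInf_le_csInf (bddBelow_constrained B m _) ⟨_, y₀, hy₀, rfl⟩
      (Set.image_mono fun y hy => ⟨hy.1, fun p hp => (hy.2 p hp).trans hab⟩)
  have hbdd : ∀ δ : ℝ, 0 < δ →
      constrainedInf B m δ ≤ (‖CFC.sqrt (hermPart B)‖ * ‖B ^ m‖) ^ 2 := by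
    intro δ hδ
    obtain ⟨y, hy, hy'⟩ := exists_nearly_conservative hB hm hδ
    refine (constrainedInf_le B m hy hy').trans ?_
    gcongr
    have := ((CFC.sqrt (hermPart B)) * B ^ m).le_opNorm y
    rw [hy, mul_one] at this
    exact this.trans (norm_mul_le _ _)
  have hbdd' : BddAbove (constrainedInf B m '' Set.Ioi 0) :=
    ⟨_, by rintro _ ⟨δ, hδ, rfl⟩; exact hbdd δ hδ⟩
  refine ⟨_, ?_, hanti.tendsto_nhdsGT hbdd'⟩
  obtain ⟨κ, hκ, hco⟩ := (hcCondition_iff hB m).1 hm.1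
  -- Chosen so that `m * δ ^ 2 ≤ κ / 2`: the terms below `m` then use at most half of the coercivity
  -- constant.
  set δ : ℝ := √(κ / (2 * (m + 1))) with hδdef
  have hδ : 0 < δ := Real.sqrt_pos.2 (by positivity)
  have hδ2 : δ ^ 2 = κ / (2 * (m + 1)) := Real.sq_sqrt (by positivity)
  refine lt_of_lt_of_le (half_pos hκ) (le_trans ?_ (le_csSup hbdd' ⟨δ, hδ, rfl⟩))
  obtain ⟨y₀, hy₀⟩ := exists_nearly_conservative hB hm hδ
  refine le_csInf ⟨_, y₀, hy₀, rfl⟩ ?_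
  rintro _ ⟨y, ⟨hy1, hy2⟩, rfl⟩
  have h1 := hco y
  rw [Finset.sum_range_succ, hy1] at h1
  have h2 : ∑ j ∈ Finset.range m, ‖CFC.sqrt (hermPart B) ((B ^ j) y)‖ ^ 2 ≤ m * δ ^ 2 := by
    refine (Finset.sum_le_card_nsmul _ _ (δ ^ 2) fun j hj => ?_).trans (by simp)
    have := hy2 j (Finset.mem_range.1 hj)
    gcongr
  have h3 : (m : ℝ) * δ ^ 2 ≤ κ / 2 := by
    rw [hδ2]
    field_simp
    linarith
  show κ / 2 ≤ ‖CFC.sqrt (hermPart B) ((B ^ m) y)‖ ^ 2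
  linarith

/-! ### Energy balance of the implicit midpoint rule -/

lemma norm_add_smul_sq {B : H →L[ℂ] H} (hB : IsSemiDissipative (-B)) (s : ℝ) (x : H) :
    ‖(1 + s • B) x‖ ^ 2 =
      ‖x‖ ^ 2 + 2 * s * ‖CFC.sqrt (hermPart B) x‖ ^ 2 + s ^ 2 * ‖B x‖ ^ 2 := by
  rw [add_apply, one_apply_eq_self, smul_apply, norm_add_sq (𝕜 := ℂ), norm_smul, mul_pow,
    Real.norm_eq_abs, sq_abs, ← re_inner_self_eq hB]
  have : RCLike.re (inner ℂ x (s • B x)) = s * (inner ℂ (B x) x).re := by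
    rw [inner_smul_right_eq_smul, Complex.real_smul]
    simp only [RCLike.re_to_complex]
    rw [Complex.re_ofReal_mul, ← inner_conj_symm x (B x), Complex.conj_re]
  rw [this]
  ring

lemma norm_add_smul_sq_sub {B : H →L[ℂ] H} (hB : IsSemiDissipative (-B)) (s : ℝ) (x : H) :
    ‖(1 + s • B) x‖ ^ 2 - ‖(1 - s • B) x‖ ^ 2 =
      4 * s * ‖CFC.sqrt (hermPart B) x‖ ^ 2 := by
  have h : (1 - s • B) = 1 + (-s) • B := by rw [neg_smul, sub_eq_add_neg]
  rw [h, norm_add_smul_sq hB, norm_add_smul_sq hB]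
  ring

lemma commute_one_add_one_sub (B : H →L[ℂ] H) (s : ℝ) : Commute (1 + s • B) (1 - s • B) := by
  have h : ∀ a : H →L[ℂ] H, Commute (1 + a) (1 - a) := fun a => by
    show _ = _
    noncomm_ring
  exact h _

/-- The energy balance of `k` steps of the implicit midpoint rule. -/
lemma norm_pow_sq_sub {B : H →L[ℂ] H} (hB : IsSemiDissipative (-B)) (s : ℝ) (k : ℕ) (y : H) :
    ‖((1 + s • B) ^ k) y‖ ^ 2 - ‖((1 - s • B) ^ k) y‖ ^ 2 = 4 * s * ∑ j ∈ Finset.range k,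
      ‖CFC.sqrt (hermPart B) (((1 + s • B) ^ (k - 1 - j) * (1 - s • B) ^ j) y)‖ ^ 2 := by
  induction k generalizing y with
  | zero => simp
  | succ k ih =>
    -- Telescoping: the outermost factor `1 + s • B` is exchanged for `1 - s • B`, commuted inwards
    -- onto `y`, and the induction hypothesis exchanges the rest.
    have h1 := ih ((1 - s • B) y)
    have h2 := norm_add_smul_sq_sub hB s (((1 + s • B) ^ k) y)
    have h3 : (1 - s • B) (((1 + s • B) ^ k) y) = ((1 + s • B) ^ k) ((1 - s • B) y) := by
      rw [← mul_apply_eq_comp, ← mul_apply_eq_comp,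
        ((commute_one_add_one_sub B s).pow_left k).eq]
    rw [h3] at h2
    rw [Finset.sum_range_succ', mul_add, pow_succ' (1 + s • B), pow_succ (1 - s • B) k,
      mul_apply_eq_comp, mul_apply_eq_comp]
    have h4 : ∀ j ∈ Finset.range k,
        ‖CFC.sqrt (hermPart B) (((1 + s • B) ^ (k + 1 - 1 - (j + 1)) *
          (1 - s • B) ^ (j + 1)) y)‖ ^ 2 = ‖CFC.sqrt (hermPart B)
          (((1 + s • B) ^ (k - 1 - j) * (1 - s • B) ^ j) ((1 - s • B) y))‖ ^ 2 := by
      intro j _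
      have e : k + 1 - 1 - (j + 1) = k - 1 - j := by omega
      rw [e, pow_succ (1 - s • B), ← mul_assoc]
      rfl
    rw [Finset.sum_congr rfl h4]
    simp only [Nat.add_sub_cancel, Nat.sub_zero, pow_zero, mul_one]
    linarith

/-- Since `Re ⟨Bx, x⟩ ≥ 0`, the form of `1 + s • B` is bounded below by `‖x‖ ^ 2`, and coercivity
gives invertibility. -/
lemma isUnit_one_add_smul {B : H →L[ℂ] H} (hB : IsSemiDissipative (-B)) {s : ℝ} (hs : 0 ≤ s) :
    IsUnit (1 + s • B) := by
  refine ContinuousLinearMap.isUnit_of_forall_le_norm_inner_map _ (c := 1) one_pos fun x => ?_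
  refine le_trans ?_ (Complex.re_le_norm _)
  rw [add_apply, one_apply_eq_self, smul_apply, inner_add_left, inner_smul_left_eq_smul,
    Complex.add_re, Complex.real_smul, Complex.re_ofReal_mul, re_inner_self_eq hB]
  have : (inner ℂ x x).re = ‖x‖ ^ 2 := inner_self_eq_norm_sq (𝕜 := ℂ) x
  rw [this, NNReal.coe_one, mul_one]
  have : 0 ≤ s * ‖CFC.sqrt (hermPart B) x‖ ^ 2 := by positivity
  linarith

lemma norm_le_norm_one_add_smul_pow {B : H →L[ℂ] H} (hB : IsSemiDissipative (-B)) {s : ℝ}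
    (hs : 0 ≤ s) (k : ℕ) (x : H) : ‖x‖ ≤ ‖((1 + s • B) ^ k) x‖ := by
  induction k with
  | zero => simp
  | succ k ih =>
    refine ih.trans ?_
    rw [pow_succ', mul_apply_eq_comp]
    refine (pow_le_pow_iff_left₀ (norm_nonneg _) (norm_nonneg _) two_ne_zero).1 ?_
    rw [norm_add_smul_sq hB s (((1 + s • B) ^ k) x)]
    have h1 : 0 ≤ s * ‖CFC.sqrt (hermPart B) (((1 + s • B) ^ k) x)‖ ^ 2 := by positivity
    have h2 : 0 ≤ s ^ 2 * ‖B (((1 + s • B) ^ k) x)‖ ^ 2 := by positivity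
    linarith

lemma scaledCayley_neg (B : H →L[ℂ] H) (τ : ℝ) :
    scaledCayley τ (-B) = Ring.inverse (1 + (τ / 2) • B) * (1 - (τ / 2) • B) := by
  rw [scaledCayley, smul_neg, sub_neg_eq_add, ← sub_eq_add_neg]

lemma scaledCayley_pow_mul {B : H →L[ℂ] H} (hB : IsSemiDissipative (-B)) {τ : ℝ} (hτ : 0 ≤ τ)
    (k : ℕ) : scaledCayley τ (-B) ^ k * (1 + (τ / 2) • B) ^ k = (1 - (τ / 2) • B) ^ k := by
  have hu := isUnit_one_add_smul hB (by positivity : (0 : ℝ) ≤ τ / 2)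
  have hc := commute_one_add_one_sub B (τ / 2)
  have h1 : Commute (scaledCayley τ (-B)) (1 + (τ / 2) • B) := by
    rw [scaledCayley_neg]
    refine Commute.mul_left ?_ hc.symm
    show _ = _
    rw [Ring.inverse_mul_cancel _ hu, Ring.mul_inverse_cancel _ hu]
  rw [← h1.mul_pow]
  congr 1
  rw [scaledCayley_neg, mul_assoc, ← hc.eq, ← mul_assoc, Ring.inverse_mul_cancel _ hu, one_mul]

/-- Evaluating at `(1 + (τ / 2) • B) ^ k y` clears the inverses, so the dissipation involves only
polynomials in `B`. No input is lost, by `surjective_one_add_smul_pow`. -/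
lemma norm_scaledCayley_pow_sq {B : H →L[ℂ] H} (hB : IsSemiDissipative (-B)) {τ : ℝ}
    (hτ : 0 ≤ τ) (k : ℕ) (y : H) :
    ‖(scaledCayley τ (-B) ^ k) (((1 + (τ / 2) • B) ^ k) y)‖ ^ 2 =
      ‖((1 + (τ / 2) • B) ^ k) y‖ ^ 2 - 2 * τ * ∑ j ∈ Finset.range k,
      ‖CFC.sqrt (hermPart B)
        (((1 + (τ / 2) • B) ^ (k - 1 - j) * (1 - (τ / 2) • B) ^ j) y)‖ ^ 2 := by
  rw [← mul_apply_eq_comp, scaledCayley_pow_mul hB hτ]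
  have := norm_pow_sq_sub hB (τ / 2) k y
  linarith

lemma surjective_one_add_smul_pow {B : H →L[ℂ] H} (hB : IsSemiDissipative (-B)) {s : ℝ}
    (hs : 0 ≤ s) (k : ℕ) (x : H) : ∃ y, ((1 + s • B) ^ k) y = x := by
  obtain ⟨u, hu⟩ := (isUnit_one_add_smul hB hs).pow k
  refine ⟨(↑u⁻¹ : H →L[ℂ] H) x, ?_⟩
  rw [← hu, ← mul_apply_eq_comp, Units.mul_inv, one_apply_eq_self]

lemma norm_scaledCayley_pow_le_one {B : H →L[ℂ] H} (hB : IsSemiDissipative (-B)) {τ : ℝ}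
    (hτ : 0 ≤ τ) (k : ℕ) : ‖scaledCayley τ (-B) ^ k‖ ≤ 1 := by
  refine ContinuousLinearMap.opNorm_le_bound _ zero_le_one fun x => ?_
  obtain ⟨y, rfl⟩ := surjective_one_add_smul_pow hB (by positivity : (0 : ℝ) ≤ τ / 2) k x
  rw [one_mul]
  refine (pow_le_pow_iff_left₀ (norm_nonneg _) (norm_nonneg _) two_ne_zero).1 ?_
  rw [norm_scaledCayley_pow_sq hB hτ, sub_le_self_iff]
  positivity

/-! ### Powers up to the index have norm one -/

/-- Each factor `1 + s • B` raises the power of `B` by at most one, so it costs one order of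
smallness and a factor `1 + |s|`. -/
lemma norm_comp_pow_one_add_smul_le (S B : H →L[ℂ] H) {s δ : ℝ} (n i : ℕ) {x : H}
    (h : ∀ p < n + i, ‖S ((B ^ p) x)‖ ≤ δ) :
    ∀ p < n, ‖S ((B ^ p) (((1 + s • B) ^ i) x))‖ ≤ (1 + |s|) ^ i * δ := by
  induction i generalizing n with
  | zero => simpa using h
  | succ i ih =>
    intro p hp
    have h0 := ih (n + 1) (fun q hq => h q (by omega))
    have h1 := h0 p (by omega)
    have h2 := h0 (p + 1) (by omega)
    have h3 : S ((B ^ p) (((1 + s • B) ^ (i + 1)) x)) =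
        S ((B ^ p) (((1 + s • B) ^ i) x)) + s • S ((B ^ (p + 1)) (((1 + s • B) ^ i) x)) := by
      rw [pow_succ' (1 + s • B), mul_apply_eq_comp, add_apply, one_apply_eq_self, smul_apply,
        pow_succ B, mul_apply_eq_comp, map_add, map_add, ContinuousLinearMap.map_smul_of_tower,
        ContinuousLinearMap.map_smul_of_tower]
    rw [h3]
    refine (norm_add_le _ _).trans ?_
    rw [norm_smul, Real.norm_eq_abs, pow_succ (1 + |s|)]
    have := mul_le_mul_of_nonneg_left h2 (abs_nonneg s)
    linarith

lemma norm_scaledCayley_pow_eq_one [Nontrivial H] {B : H →L[ℂ] H}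
    (hB : IsSemiDissipative (-B)) {m : ℕ} (hm : IsHCIndex B m) {τ : ℝ} (hτ : 0 < τ) {k : ℕ}
    (hk : k ≤ m) : ‖scaledCayley τ (-B) ^ k‖ = 1 := by
  refine le_antisymm (norm_scaledCayley_pow_le_one hB hτ.le k) ?_
  set N := ‖scaledCayley τ (-B) ^ k‖ with hN
  have hN0 : 0 ≤ N := norm_nonneg _
  set s := τ / 2 with hs
  set S := CFC.sqrt (hermPart B) with hS
  set C := (1 + |s|) ^ k with hC
  have hC0 : 0 ≤ C := by positivity
  have key : ∀ δ : ℝ, 0 < δ → 1 - 2 * τ * (k * (C * δ) ^ 2) ≤ N ^ 2 := by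
    intro δ hδ
    obtain ⟨y, hy, hyp⟩ := exists_nearly_conservative hB hm hδ
    have h1 := norm_scaledCayley_pow_sq hB hτ.le k y
    have h2 : ‖(scaledCayley τ (-B) ^ k) (((1 + s • B) ^ k) y)‖ ^ 2
        ≤ N ^ 2 * ‖((1 + s • B) ^ k) y‖ ^ 2 := by
      rw [← mul_pow]
      gcongr
      exact ContinuousLinearMap.le_opNorm _ _
    have h3 : 1 ≤ ‖((1 + s • B) ^ k) y‖ ^ 2 := by
      have := norm_le_norm_one_add_smul_pow hB (s := s) (by positivity) k y
      rw [hy] at this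
      exact one_le_pow₀ this
    have h4 : ∑ j ∈ Finset.range k,
        ‖S (((1 + s • B) ^ (k - 1 - j) * (1 - s • B) ^ j) y)‖ ^ 2 ≤ k * (C * δ) ^ 2 := by
      refine (Finset.sum_le_card_nsmul _ _ ((C * δ) ^ 2) fun j hj => ?_).trans (by simp)
      have hj' := Finset.mem_range.1 hj
      -- The `j` factors `1 - s • B` leave smallness for `p < k - j`; the other `k - 1 - j` factors
      -- use it up to the single order `p = 0`. This is where `k ≤ m` is needed.
      have e1 := norm_comp_pow_one_add_smul_le S B (s := -s) (k - j) j (x := y) (δ := δ)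
        (fun p hp => hyp p (by omega))
      have e2 := norm_comp_pow_one_add_smul_le S B (s := s) 1 (k - 1 - j)
        (fun p hp => e1 p (by omega)) 0 one_pos
      rw [abs_neg, ← mul_assoc, ← pow_add, neg_smul, ← sub_eq_add_neg, pow_zero,
        one_apply_eq_self] at e2
      gcongr
      rw [mul_apply_eq_comp]
      exact e2.trans (mul_le_mul_of_nonneg_right
        (pow_le_pow_right₀ (by linarith [abs_nonneg s]) (by omega)) hδ.le)
    have h5 : 2 * τ * ∑ j ∈ Finset.range k,
        ‖S (((1 + s • B) ^ (k - 1 - j) * (1 - s • B) ^ j) y)‖ ^ 2 ≤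
        2 * τ * (k * (C * δ) ^ 2) := by gcongr
    have h7 : 0 ≤ 2 * τ * (k * (C * δ) ^ 2) := by positivity
    -- Because the input has norm at least one, the relative loss is at most the absolute loss.
    by_contra hcon
    push Not at hcon
    nlinarith
  have hlim : Tendsto (fun δ : ℝ => 1 - 2 * τ * (k * (C * δ) ^ 2)) (𝓝[>] 0) (𝓝 1) := by
    have : Continuous (fun δ : ℝ => 1 - 2 * τ * (k * (C * δ) ^ 2)) := by fun_prop
    have h := this.tendsto 0
    simp only [mul_zero, zero_pow two_ne_zero, sub_zero] at h
    exact h.mono_left nhdsWithin_le_nhds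
  have h1 : 1 ≤ N ^ 2 := le_of_tendsto hlim
    (eventually_mem_nhdsWithin.mono fun δ hδ => key δ hδ)
  by_contra hcon
  push Not at hcon
  nlinarith

/-! ### Central differences of the grid function -/

lemma gridNorm_eq_one [Nontrivial H] {B : H →L[ℂ] H}
    (hB : IsSemiDissipative (-B)) {m : ℕ} (hm : IsHCIndex B m) {τ : ℝ} (hτ : 0 < τ) {k : ℤ}
    (hk : k.natAbs ≤ m) : gridNorm B τ k = 1 := by
  rw [gridNorm, norm_scaledCayley_pow_eq_one hB hm hτ hk]
  norm_num

lemma gridNorm_neg {B : H →L[ℂ] H} {τ : ℝ} {k : ℤ} (hk : 0 < k) :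
    gridNorm B τ (-k) = 2 - gridNorm B τ k := by
  rw [gridNorm, gridNorm, if_neg (by omega), if_pos hk.le, Int.natAbs_neg]

lemma sum_alternating_choose (n : ℕ) :
    ∑ i ∈ Finset.range (n + 1), (-1 : ℝ) ^ i * (n.choose i : ℝ) = if n = 0 then 1 else 0 := by
  exact_mod_cast congrArg (Int.cast : ℤ → ℝ) (Int.alternating_sum_range_choose (n := n))

/-- The stencil stays inside `|k| ≤ m`, where the grid function is constantly one. -/
lemma centralDiff_gridNorm_of_le [Nontrivial H] {B : H →L[ℂ] H}
    (hB : IsSemiDissipative (-B)) {m : ℕ} (hm : IsHCIndex B m) {τ : ℝ} (hτ : 0 < τ) {j : ℕ}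
    (hj : j ≤ 2 * m) : centralDiff j (gridNorm B τ) 0 = if j = 0 then 1 else 0 := by
  rw [centralDiff, ← sum_alternating_choose, Finset.mul_sum]
  refine Finset.sum_congr rfl fun i hi => ?_
  have hi' := Finset.mem_range.1 hi
  rw [gridNorm_eq_one hB hm hτ (by omega), gridNorm_eq_one hB hm hτ (by omega)]
  ring

/-- Only the end nodes `±(m + 1)` differ from one. The odd extension about `(0, 1)` and the sign
`(-1) ^ (2 * m + 1)` make both contribute `φ - 1`, and the mean of the two shifted differences
restores a single copy. -/
lemma centralDiff_gridNorm_odd [Nontrivial H] {B : H →L[ℂ] H}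
    (hB : IsSemiDissipative (-B)) {m : ℕ} (hm : IsHCIndex B m) {τ : ℝ} (hτ : 0 < τ) :
    centralDiff (2 * m + 1) (gridNorm B τ) 0 = gridNorm B τ ((m : ℤ) + 1) - 1 := by
  set φ := gridNorm B τ ((m : ℤ) + 1) with hφ
  have h0 := sum_alternating_choose (2 * m + 1)
  rw [if_neg (by omega)] at h0
  have e1 : (2 * m + 1 + 1) / 2 = m + 1 := by omega
  have e2 : (2 * m + 1) / 2 = m := by omega
  have h : ∀ i ∈ Finset.range (2 * m + 1 + 1), (-1 : ℝ) ^ i * ((2 * m + 1).choose i : ℝ) *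
      (gridNorm B τ (0 + ((m + 1 : ℕ) : ℤ) - (i : ℤ)) + gridNorm B τ (0 + (m : ℤ) - (i : ℤ))) =
      2 * ((-1 : ℝ) ^ i * ((2 * m + 1).choose i : ℝ)) + ((if i = 0 then φ - 1 else 0) +
        (if i = 2 * m + 1 then φ - 1 else 0)) := by
    intro i hi
    have hi' := Finset.mem_range.1 hi
    rcases Nat.eq_zero_or_pos i with rfl | hpos
    · have a1 : (0 + ((m + 1 : ℕ) : ℤ) - ((0 : ℕ) : ℤ)) = (m : ℤ) + 1 := by push_cast; ring
      rw [a1, gridNorm_eq_one hB hm hτ (k := 0 + (m : ℤ) - ((0 : ℕ) : ℤ)) (by omega), ← hφ]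
      simp
      ring
    · rcases eq_or_ne i (2 * m + 1) with rfl | hne
      · have a1 : (0 + (m : ℤ) - ((2 * m + 1 : ℕ) : ℤ)) = -((m : ℤ) + 1) := by push_cast; ring
        rw [a1, gridNorm_eq_one hB hm hτ
          (k := 0 + ((m + 1 : ℕ) : ℤ) - ((2 * m + 1 : ℕ) : ℤ)) (by omega),
          gridNorm_neg (by omega), ← hφ, Odd.neg_one_pow ⟨m, rfl⟩]
        simp
        ring
      · rw [gridNorm_eq_one hB hm hτ (by omega), gridNorm_eq_one hB hm hτ (by omega),
          if_neg (by omega), if_neg hne]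
        ring
  rw [centralDiff, e1, e2, Finset.sum_congr rfl h, Finset.sum_add_distrib, ← Finset.mul_sum, h0,
    Finset.sum_add_distrib, Finset.sum_ite_eq', Finset.sum_ite_eq',
    if_pos (Finset.mem_range.2 (by omega)), if_pos (Finset.mem_range.2 (by omega))]
  ring

/-! ### Extracting single powers of `B`, and trial states -/

section Averages

open MeasureTheory

variable {X : Type*} [TopologicalSpace X] [CompactSpace X] [MeasurableSpace X]
  [OpensMeasurableSpace X] (μ : Measure X) [IsFiniteMeasure μ]

lemma integrable_of_continuous {E : Type*} [NormedAddCommGroup E] {f : X → E}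
    (hf : Continuous f) : Integrable f μ :=
  hf.integrable_of_hasCompactSupport (HasCompactSupport.of_compactSpace f)

/-- Cauchy–Schwarz for the average of a vector-valued function against a weight. -/
lemma norm_integral_smul_le {h : X → ℝ} (hh : Continuous h) {w : X → H} (hw : Continuous w) :
    ‖∫ σ, h σ • w σ ∂μ‖ ≤ √((∫ σ, h σ ^ 2 ∂μ) * ∫ σ, ‖w σ‖ ^ 2 ∂μ) := by
  have h1 : ‖∫ σ, h σ • w σ ∂μ‖ ≤ ∫ σ, |h σ| * ‖w σ‖ ∂μ := by
    refine (norm_integral_le_integral_norm _).trans_eq ?_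
    simp only [norm_smul, Real.norm_eq_abs]
  refine h1.trans (Real.le_sqrt_of_sq_le ?_)
  have h2 : ∀ r : ℝ, 0 ≤ (∫ σ, h σ ^ 2 ∂μ) * (r * r) +
      (2 * ∫ σ, |h σ| * ‖w σ‖ ∂μ) * r + ∫ σ, ‖w σ‖ ^ 2 ∂μ := by
    intro r
    have e : (∫ σ, h σ ^ 2 ∂μ) * (r * r) + (2 * ∫ σ, |h σ| * ‖w σ‖ ∂μ) * r + ∫ σ, ‖w σ‖ ^ 2 ∂μ
        = ∫ σ, (|h σ| * r + ‖w σ‖) ^ 2 ∂μ := by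
      rw [← integral_mul_const, ← integral_const_mul, ← integral_mul_const, ← integral_add,
        ← integral_add]
      · refine integral_congr_ae (Eventually.of_forall fun σ => ?_)
        simp only
        rw [← sq_abs (h σ)]
        ring
      all_goals exact integrable_of_continuous μ (by fun_prop)
    rw [e]
    exact integral_nonneg fun σ => sq_nonneg _
  have h3 := discrim_le_zero h2
  rw [discrim] at h3
  linarith

/-- Averaging `S (G σ y)` against a weight that is orthogonal to `a q` for `q < p` extracts the
contribution of `B ^ p`. -/
lemma exists_norm_pow_le_sqrt_add (S B : H →L[ℂ] H) {m : ℕ} {a : ℕ → X → ℝ}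
    (ha : ∀ q, Continuous (a q)) {g : X → ℝ} (hg : Continuous g) {p : ℕ} (hp : p ≤ m)
    (hg0 : ∀ q < p, ∫ σ, g σ * a q σ ∂μ = 0) (hg1 : ∫ σ, g σ * a p σ ∂μ = 1) {C₁ : ℝ}
    (hC₁ : 0 ≤ C₁) :
    ∃ C, 0 ≤ C ∧ ∀ t : ℝ, 0 < t → t ≤ 1 → ∀ G : X → H →L[ℂ] H, Continuous G →
      (∀ σ, ‖G σ - ∑ q ∈ Finset.range (m + 1), (t ^ q * a q σ) • B ^ q‖ ≤ C₁ * t ^ (m + 1)) →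
      ∀ y : H, t ^ p * ‖S ((B ^ p) y)‖ ≤
        √((∫ σ, g σ ^ 2 ∂μ) * ∫ σ, ‖S (G σ y)‖ ^ 2 ∂μ) + C * t ^ (p + 1) * ‖y‖ := by
  -- `b q` pairs the weight with `a q`: it vanishes for `q < p`, equals one at `p`, and for `q > p`
  -- comes with at least `t ^ (p + 1)`.
  set b : ℕ → ℝ := fun q => ∫ σ, g σ * a q σ ∂μ with hb
  refine ⟨∑ q ∈ Finset.range (m + 1), |b q| * ‖S * B ^ q‖ + (∫ σ, |g σ| ∂μ) * (‖S‖ * C₁),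
    ?_, ?_⟩
  · have : 0 ≤ ∫ σ, |g σ| ∂μ := integral_nonneg fun σ => abs_nonneg _
    positivity
  intro t ht0 ht1 G hG hGR y
  set R : X → H →L[ℂ] H :=
    fun σ => G σ - ∑ q ∈ Finset.range (m + 1), (t ^ q * a q σ) • B ^ q with hR
  have hRc : Continuous R := by fun_prop
  have hRy : Continuous fun σ => R σ y := by fun_prop
  have hGy : Continuous fun σ => G σ y := by fun_prop
  have hSG : ∀ σ, g σ • S (G σ y) = ∑ q ∈ Finset.range (m + 1),
      (g σ * a q σ) • (t ^ q • S ((B ^ q) y)) + g σ • S (R σ y) := by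
    intro σ
    have : G σ y = ∑ q ∈ Finset.range (m + 1), (t ^ q * a q σ) • (B ^ q) y + R σ y := by
      simp only [hR, sub_apply, sum_apply, smul_apply]
      abel
    rw [this, map_add, map_sum, smul_add, Finset.smul_sum]
    congr 1
    refine Finset.sum_congr rfl fun q _ => ?_
    rw [ContinuousLinearMap.map_smul_of_tower, smul_smul, smul_smul]
    congr 1
    ring
  have hint : ∫ σ, g σ • S (G σ y) ∂μ = ∑ q ∈ Finset.range (m + 1),
      b q • (t ^ q • S ((B ^ q) y)) + ∫ σ, g σ • S (R σ y) ∂μ := by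
    rw [integral_congr_ae (Eventually.of_forall hSG), integral_add, integral_finsetSum]
    · congr 1
      refine Finset.sum_congr rfl fun q _ => ?_
      rw [integral_smul_const]
    · intro q _
      exact integrable_of_continuous μ (by fun_prop)
    · exact integrable_of_continuous μ (by fun_prop)
    · exact integrable_of_continuous μ (by fun_prop)
  have hrem : ‖∫ σ, g σ • S (R σ y) ∂μ‖ ≤
      (∫ σ, |g σ| ∂μ) * (‖S‖ * C₁) * t ^ (p + 1) * ‖y‖ := by
    refine (norm_integral_le_integral_norm _).trans ?_
    rw [mul_assoc, mul_assoc, ← integral_mul_const]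
    refine integral_mono (integrable_of_continuous μ (by fun_prop))
      (integrable_of_continuous μ (by fun_prop)) fun σ => ?_
    simp only [norm_smul, Real.norm_eq_abs]
    refine mul_le_mul_of_nonneg_left ?_ (abs_nonneg _)
    calc ‖S (R σ y)‖ ≤ ‖S‖ * (‖R σ‖ * ‖y‖) := S.le_opNorm_of_le ((R σ).le_opNorm y)
      _ ≤ ‖S‖ * ((C₁ * t ^ (p + 1)) * ‖y‖) := by
        gcongr
        refine (hGR σ).trans ?_
        have := pow_le_pow_of_le_one ht0.le ht1 (show p + 1 ≤ m + 1 by omega)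
        gcongr
      _ = _ := by ring
  have hterm : ∀ q ∈ (Finset.range (m + 1)).erase p,
      ‖b q • (t ^ q • S ((B ^ q) y))‖ ≤ |b q| * ‖S * B ^ q‖ * (t ^ (p + 1) * ‖y‖) := by
    intro q hq
    rcases lt_trichotomy q p with hlt | rfl | hgt
    · have : b q = 0 := hg0 q hlt
      simp [this]
    · exact absurd rfl (Finset.ne_of_mem_erase hq)
    · rw [norm_smul, norm_smul, Real.norm_eq_abs, Real.norm_of_nonneg (by positivity), mul_assoc]
      refine mul_le_mul_of_nonneg_left ?_ (abs_nonneg _)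
      have h1 : ‖S ((B ^ q) y)‖ ≤ ‖S * B ^ q‖ * ‖y‖ := (S * B ^ q).le_opNorm y
      have h2 : t ^ q ≤ t ^ (p + 1) := pow_le_pow_of_le_one ht0.le ht1 hgt
      calc t ^ q * ‖S ((B ^ q) y)‖ ≤ t ^ (p + 1) * (‖S * B ^ q‖ * ‖y‖) := by gcongr
        _ = _ := by ring
  have hpm : p ∈ Finset.range (m + 1) := Finset.mem_range.2 (by omega)
  rw [← Finset.add_sum_erase _ _ hpm, show b p = 1 from hg1, one_smul] at hint
  have hmain : t ^ p • S ((B ^ p) y) = ∫ σ, g σ • S (G σ y) ∂μ -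
      ∑ q ∈ (Finset.range (m + 1)).erase p, b q • (t ^ q • S ((B ^ q) y)) -
      ∫ σ, g σ • S (R σ y) ∂μ := by
    rw [hint]
    abel
  have hsum : ‖∑ q ∈ (Finset.range (m + 1)).erase p, b q • (t ^ q • S ((B ^ q) y))‖ ≤
      (∑ q ∈ Finset.range (m + 1), |b q| * ‖S * B ^ q‖) * (t ^ (p + 1) * ‖y‖) := by
    refine (norm_sum_le_of_le _ hterm).trans ?_
    rw [← Finset.sum_mul]
    gcongr
    exact Finset.erase_subset _ _
  have hCS := norm_integral_smul_le μ hg (w := fun σ => S (G σ y)) (by fun_prop)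
  calc t ^ p * ‖S ((B ^ p) y)‖ = ‖t ^ p • S ((B ^ p) y)‖ := by
        rw [norm_smul, Real.norm_of_nonneg (by positivity)]
    _ ≤ _ := by
        rw [hmain]
        refine (norm_sub_le _ _).trans ((add_le_add_left (norm_sub_le _ _) _).trans ?_)
        linarith

/-- The perturbed vectors used as trial states. -/
def trialState (B : H →L[ℂ] H) (w : ℕ → ℝ) (m : ℕ) (t : ℝ) (y : H) : H :=
  ∑ i ∈ Finset.range (m + 1), (t ^ i * w (m - i)) • (B ^ i) y

lemma exists_norm_trialState_sub_le (B : H →L[ℂ] H) {w : ℕ → ℝ} {m : ℕ} (hw : w m = 1) :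
    ∃ C, 0 ≤ C ∧ ∀ t : ℝ, 0 < t → t ≤ 1 → ∀ y : H, ‖y‖ = 1 →
      ‖trialState B w m t y - y‖ ≤ C * t := by
  refine ⟨∑ i ∈ Finset.range m, |w (m - (i + 1))| * ‖B ^ (i + 1)‖, by positivity, ?_⟩
  intro t ht0 ht1 y hy
  rw [trialState, Finset.sum_range_succ', Nat.sub_zero, hw, pow_zero, pow_zero, one_mul,
    one_smul, one_apply_eq_self, add_sub_cancel_right, Finset.sum_mul]
  refine norm_sum_le_of_le _ fun i _ => ?_
  have h1 : ‖(B ^ (i + 1)) y‖ ≤ ‖B ^ (i + 1)‖ := by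
    simpa [hy] using (B ^ (i + 1)).le_opNorm y
  have h2 : t ^ (i + 1) ≤ t := by
    simpa using pow_le_pow_of_le_one ht0.le ht1 (show 1 ≤ i + 1 by omega)
  rw [norm_smul, norm_mul, Real.norm_eq_abs, Real.norm_eq_abs, abs_of_pos (by positivity)]
  calc t ^ (i + 1) * |w (m - (i + 1))| * ‖(B ^ (i + 1)) y‖
      ≤ t * |w (m - (i + 1))| * ‖B ^ (i + 1)‖ := by gcongr
    _ = _ := by ring

lemma exists_bound_of_continuous {ι : Type*} (s : Finset ι) {a : ι → X → ℝ}
    (ha : ∀ q, Continuous (a q)) : ∃ A : ℝ, 0 ≤ A ∧ ∀ q ∈ s, ∀ σ, |a q σ| ≤ A := by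
  have h : ∀ q, ∃ A : ℝ, ∀ σ, |a q σ| ≤ A := fun q => by
    obtain ⟨A, hA⟩ := isCompact_univ.exists_bound_of_continuousOn (ha q).continuousOn
    exact ⟨A, fun σ => hA σ trivial⟩
  choose A hA using h
  refine ⟨∑ q ∈ s, |A q|, by positivity, fun q hq σ => ((hA q σ).trans (le_abs_self _)).trans ?_⟩
  exact Finset.single_le_sum (f := fun q => |A q|) (fun _ _ => abs_nonneg _) hq

/-- In the double sum over `t ^ (p + i) • S B ^ (p + i) y`, terms with `p + i < m` are small by the
tolerance on `y`, and those with `p + i > m` by their power of `t`. The antidiagonal `p + i = m`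
survives, which is why `trialState` carries the index `m - i`. -/
lemma exists_norm_trialState_expansion_le (S B : H →L[ℂ] H) {m : ℕ} {a : ℕ → X → ℝ}
    (ha : ∀ q, Continuous (a q)) (w : ℕ → ℝ) {C₁ : ℝ} (hC₁ : 0 ≤ C₁) :
    ∃ C, 0 ≤ C ∧ ∀ t : ℝ, 0 < t → t ≤ 1 → ∀ G : X → H →L[ℂ] H,
      (∀ σ, ‖G σ - ∑ q ∈ Finset.range (m + 1), (t ^ q * a q σ) • B ^ q‖ ≤ C₁ * t ^ (m + 1)) →
      ∀ y : H, ‖y‖ = 1 → (∀ p < m, ‖S ((B ^ p) y)‖ ≤ t ^ (m + 1)) → ∀ σ,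
      ‖S (G σ (trialState B w m t y)) -
        (t ^ m * ∑ p ∈ Finset.range (m + 1), w p * a p σ) • S ((B ^ m) y)‖ ≤
        C * t ^ (m + 1) := by
  obtain ⟨A, hA0, hA⟩ := exists_bound_of_continuous (Finset.range (m + 1)) ha
  -- Powers up to `p + i = 2 * m` occur; the added one gives `1 ≤ K`, so that `K` also serves the
  -- terms controlled by the tolerance.
  set K := ∑ q ∈ Finset.range (2 * m + 1), ‖S * B ^ q‖ + 1 with hK
  have hK1 : 1 ≤ K := by
    rw [hK]
    exact le_add_of_nonneg_left (by positivity)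
  set W := ∑ i ∈ Finset.range (m + 1), |w (m - i)| with hW
  have hW0 : 0 ≤ W := by positivity
  set Y := ∑ i ∈ Finset.range (m + 1), |w (m - i)| * ‖B ^ i‖ with hY
  have hY0 : 0 ≤ Y := by positivity
  refine ⟨∑ _p ∈ Finset.range (m + 1), A * K * W + ‖S‖ * (C₁ * Y), by positivity, ?_⟩
  intro t ht0 ht1 G hGR y hy hyp σ
  set x := trialState B w m t y with hx
  have hxY : ‖x‖ ≤ Y := by
    rw [hx, trialState]
    refine norm_sum_le_of_le _ fun i _ => ?_
    have h1 : ‖(B ^ i) y‖ ≤ ‖B ^ i‖ := by simpa [hy] using (B ^ i).le_opNorm y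
    have h2 : t ^ i ≤ 1 := pow_le_one₀ ht0.le ht1
    rw [norm_smul, norm_mul, Real.norm_eq_abs, Real.norm_eq_abs, abs_of_pos (by positivity)]
    calc t ^ i * |w (m - i)| * ‖(B ^ i) y‖ ≤ 1 * |w (m - i)| * ‖B ^ i‖ := by gcongr
      _ = _ := by ring
  set R : H →L[ℂ] H := G σ - ∑ q ∈ Finset.range (m + 1), (t ^ q * a q σ) • B ^ q with hR
  have hRx : ‖S (R x)‖ ≤ ‖S‖ * (C₁ * Y) * t ^ (m + 1) := by
    calc ‖S (R x)‖ ≤ ‖S‖ * (‖R‖ * ‖x‖) := S.le_opNorm_of_le (R.le_opNorm x)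
      _ ≤ ‖S‖ * ((C₁ * t ^ (m + 1)) * Y) := by
        gcongr
        exact hGR σ
      _ = _ := by ring
  set f : ℕ → ℕ → H := fun p i =>
    (t ^ (p + i) * (a p σ * w (m - i))) • S ((B ^ (p + i)) y) with hf
  have hSG : S (G σ x) = ∑ p ∈ Finset.range (m + 1), ∑ i ∈ Finset.range (m + 1), f p i +
      S (R x) := by
    have : G σ x = ∑ p ∈ Finset.range (m + 1), (t ^ p * a p σ) • (B ^ p) x + R x := by
      simp only [hR, sub_apply, sum_apply, smul_apply]
      abel
    rw [this, map_add, map_sum]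
    congr 1
    refine Finset.sum_congr rfl fun p _ => ?_
    rw [hx, trialState, map_sum, Finset.smul_sum, map_sum]
    refine Finset.sum_congr rfl fun i _ => ?_
    rw [ContinuousLinearMap.map_smul_of_tower, ContinuousLinearMap.map_smul_of_tower,
      ContinuousLinearMap.map_smul_of_tower, smul_smul]
    simp only [hf, pow_add B, mul_apply_eq_comp]
    congr 1
    ring
  have hdiag : (t ^ m * ∑ p ∈ Finset.range (m + 1), w p * a p σ) • S ((B ^ m) y) =
      ∑ p ∈ Finset.range (m + 1), f p (m - p) := by
    rw [Finset.mul_sum, Finset.sum_smul]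
    refine Finset.sum_congr rfl fun p hp => ?_
    have hp' := Finset.mem_range.1 hp
    simp only [hf]
    rw [show p + (m - p) = m by omega, show m - (m - p) = p by omega, mul_comm (w p)]
  have hf_le : ∀ p ∈ Finset.range (m + 1), ∀ i ∈ (Finset.range (m + 1)).erase (m - p),
      ‖f p i‖ ≤ A * K * |w (m - i)| * t ^ (m + 1) := by
    intro p hp i hi
    have hp' := Finset.mem_range.1 hp
    have hi' := Finset.mem_range.1 (Finset.mem_of_mem_erase hi)
    have hne := Finset.ne_of_mem_erase hi
    have hkey : t ^ (p + i) * ‖S ((B ^ (p + i)) y)‖ ≤ t ^ (m + 1) * K := by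
      rcases lt_or_gt_of_ne (show p + i ≠ m by omega) with hlt | hgt
      · have h1 := hyp _ hlt
        have h2 : t ^ (p + i) ≤ 1 := pow_le_one₀ ht0.le ht1
        calc t ^ (p + i) * ‖S ((B ^ (p + i)) y)‖ ≤ 1 * t ^ (m + 1) := by gcongr
          _ ≤ t ^ (m + 1) * K := by
            rw [one_mul]
            exact le_mul_of_one_le_right (by positivity) hK1
      · have h1 : t ^ (p + i) ≤ t ^ (m + 1) := pow_le_pow_of_le_one ht0.le ht1 hgt
        have h2 : ‖S ((B ^ (p + i)) y)‖ ≤ K := by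
          have h3 : ‖S ((B ^ (p + i)) y)‖ ≤ ‖S * B ^ (p + i)‖ := by
            simpa [hy] using (S * B ^ (p + i)).le_opNorm y
          refine h3.trans ?_
          rw [hK]
          refine le_add_of_le_of_nonneg ?_ zero_le_one
          exact Finset.single_le_sum (f := fun q => ‖S * B ^ q‖) (fun _ _ => norm_nonneg _)
            (Finset.mem_range.2 (by omega))
        gcongr
    simp only [hf]
    rw [norm_smul, norm_mul, norm_mul, Real.norm_of_nonneg (by positivity : 0 ≤ t ^ (p + i)),
      Real.norm_eq_abs, Real.norm_eq_abs]
    calc t ^ (p + i) * (|a p σ| * |w (m - i)|) * ‖S ((B ^ (p + i)) y)‖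
        = (|a p σ| * |w (m - i)|) * (t ^ (p + i) * ‖S ((B ^ (p + i)) y)‖) := by ring
      _ ≤ (A * |w (m - i)|) * (t ^ (m + 1) * K) := by
        gcongr
        exact hA p hp σ
      _ = _ := by ring
  have hsub : S (G σ x) - (t ^ m * ∑ p ∈ Finset.range (m + 1), w p * a p σ) • S ((B ^ m) y) =
      ∑ p ∈ Finset.range (m + 1), ∑ i ∈ (Finset.range (m + 1)).erase (m - p), f p i +
      S (R x) := by
    rw [hSG, hdiag, add_sub_right_comm, ← Finset.sum_sub_distrib]
    congr 1
    refine Finset.sum_congr rfl fun p hp => ?_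
    rw [← Finset.add_sum_erase _ _ (Finset.mem_range.2 (by omega : m - p < m + 1))]
    abel
  rw [hsub, add_mul, Finset.sum_mul]
  refine (norm_add_le _ _).trans (add_le_add (norm_sum_le_of_le _ fun p hp => ?_) hRx)
  refine (norm_sum_le_of_le _ (hf_le p hp)).trans ?_
  rw [← Finset.sum_mul, ← Finset.mul_sum]
  gcongr
  rw [hW]
  gcongr
  exact Finset.erase_subset _ _

end Averages

/-! ### Two-sided short-time asymptotics from an energy balance -/

section ShortTime

open MeasureTheory

variable {X : Type*} [TopologicalSpace X] [CompactSpace X] [MeasurableSpace X]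
  [OpensMeasurableSpace X] (μ : Measure X) [IsFiniteMeasure μ]

lemma integral_sq_le_of_norm_sub_le {f : X → H} (hf : Continuous f) {u : X → ℝ}
    (hu : Continuous u) {U : ℝ} (hU : ∀ σ, |u σ| ≤ U) {v : H} {r e : ℝ} (hr : 0 ≤ r)
    (he : 0 ≤ e) (h : ∀ σ, ‖f σ - (r * u σ) • v‖ ≤ e) :
    ∫ σ, ‖f σ‖ ^ 2 ∂μ ≤ r ^ 2 * ‖v‖ ^ 2 * ∫ σ, u σ ^ 2 ∂μ +
      (2 * r * U * ‖v‖ * e + e ^ 2) * μ.real Set.univ := by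
  have h1 : ∀ σ, ‖f σ‖ ^ 2 ≤ r ^ 2 * ‖v‖ ^ 2 * u σ ^ 2 + (2 * r * U * ‖v‖ * e + e ^ 2) := by
    intro σ
    have h2 : ‖f σ‖ ≤ r * |u σ| * ‖v‖ + e := by
      have h3 : ‖(r * u σ) • v‖ = r * |u σ| * ‖v‖ := by
        rw [norm_smul, norm_mul, Real.norm_of_nonneg hr, Real.norm_eq_abs]
      have h4 := norm_add_le ((r * u σ) • v) (f σ - (r * u σ) • v)
      rw [add_sub_cancel, h3] at h4
      linarith [h σ]
    have h5 : 2 * r * |u σ| * ‖v‖ * e ≤ 2 * r * U * ‖v‖ * e := by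
      have := hU σ
      gcongr
    calc ‖f σ‖ ^ 2 ≤ (r * |u σ| * ‖v‖ + e) ^ 2 := by gcongr
      _ = r ^ 2 * ‖v‖ ^ 2 * u σ ^ 2 + (2 * r * |u σ| * ‖v‖ * e + e ^ 2) := by
        rw [← sq_abs (u σ)]
        ring
      _ ≤ _ := by linarith
  refine (integral_mono (integrable_of_continuous μ (by fun_prop))
    (integrable_of_continuous μ (by fun_prop)) h1).trans_eq ?_
  rw [integral_add (integrable_of_continuous μ (by fun_prop))
    (integrable_of_continuous μ (by fun_prop)), integral_const_mul, integral_const, smul_eq_mul,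
    mul_comm (μ.real Set.univ)]

lemma tendsto_const_mul_pow_nhdsGT {C : ℝ} (hC : 0 < C) (n : ℕ) :
    Tendsto (fun t : ℝ => C * t ^ (n + 1)) (𝓝[>] 0) (𝓝[>] 0) := by
  refine tendsto_nhdsWithin_iff.2 ⟨?_, eventually_mem_nhdsWithin.mono fun t ht => ?_⟩
  · have : Continuous fun t : ℝ => C * t ^ (n + 1) := by fun_prop
    have h := this.tendsto 0
    simp only [zero_pow (Nat.succ_ne_zero n), mul_zero] at h
    exact h.mono_left nhdsWithin_le_nhds
  · have : (0 : ℝ) < t := ht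
    exact Set.mem_Ioi.2 (by positivity)

lemma tendsto_id_nhdsGT : Tendsto (fun t : ℝ => t) (𝓝[>] 0) (𝓝 0) :=
  tendsto_id.mono_left nhdsWithin_le_nhds

lemma one_sub_le_norm_apply {K : H →L[ℂ] H} {e : ℝ} (h : ‖K - 1‖ ≤ e) (x : H) :
    (1 - e) * ‖x‖ ≤ ‖K x‖ := by
  have h1 : ‖(K - 1) x‖ ≤ e * ‖x‖ := (K - 1).le_of_opNorm_le h x
  have h2 := norm_sub_norm_le x (x - K x)
  rw [sub_sub_cancel] at h2
  rw [sub_apply, one_apply_eq_self, norm_sub_rev] at h1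
  linarith

lemma norm_apply_le_one_add {K : H →L[ℂ] H} {e : ℝ} (h : ‖K - 1‖ ≤ e) (x : H) :
    ‖K x‖ ≤ (1 + e) * ‖x‖ := by
  have h1 : ‖(K - 1) x‖ ≤ e * ‖x‖ := (K - 1).le_of_opNorm_le h x
  have h2 := norm_add_le x (K x - x)
  rw [add_sub_cancel] at h2
  rw [sub_apply, one_apply_eq_self] at h1
  linarith

/-- Trial states bound the decay of the norm from above. -/
lemma exists_tendsto_upper_bound [Nontrivial H] {B : H →L[ℂ] H} (hB : IsSemiDissipative (-B))
    {m : ℕ} (hm : IsHCIndex B m) {c₀ : ℝ} (hc : Tendsto (constrainedInf B m) (𝓝[>] 0) (𝓝 c₀))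
    {a : ℕ → X → ℝ} (ha : ∀ q, Continuous (a q)) {w : ℕ → ℝ} (hw : w m = 1) {l : ℝ}
    (hl : ∫ σ, (∑ p ∈ Finset.range (m + 1), w p * a p σ) ^ 2 ∂μ = l)
    {F : ℝ → X → H →L[ℂ] H} (hF : ∀ t, Continuous (F t)) {C₁ : ℝ} (hC₁ : 0 ≤ C₁)
    (hexp : ∀ᶠ t in 𝓝[>] (0 : ℝ), ∀ σ,
      ‖F t σ - ∑ q ∈ Finset.range (m + 1), (t ^ q * a q σ) • B ^ q‖ ≤ C₁ * t ^ (m + 1))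
    {T K : ℝ → H →L[ℂ] H} {C₂ : ℝ} (hK : ∀ᶠ t in 𝓝[>] (0 : ℝ), ‖K t - 1‖ ≤ C₂ * t)
    (hT : ∀ᶠ t in 𝓝[>] (0 : ℝ), ∀ y, ‖T t (K t y)‖ ^ 2 = ‖K t y‖ ^ 2 -
      2 * t * ∫ σ, ‖CFC.sqrt (hermPart B) (F t σ y)‖ ^ 2 ∂μ) :
    ∃ g : ℝ → ℝ, Tendsto g (𝓝[>] 0) (𝓝 (2 * (l * c₀))) ∧
      ∀ᶠ t in 𝓝[>] (0 : ℝ), (1 - ‖T t‖ ^ 2) / t ^ (2 * m + 1) ≤ g t := by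
  set S := CFC.sqrt (hermPart B) with hS
  obtain ⟨Cw, hCw0, hCw⟩ := exists_norm_trialState_sub_le B hw
  obtain ⟨C, hC0, hC⟩ := exists_norm_trialState_expansion_le S B ha w hC₁
  set u : X → ℝ := fun σ => ∑ p ∈ Finset.range (m + 1), w p * a p σ with hu
  have huc : Continuous u := by fun_prop
  obtain ⟨U, hU0, hU⟩ := exists_bound_of_continuous (Finset.range 1) (a := fun _ => u)
    fun _ => huc
  set V := ‖S * B ^ m‖ with hV
  set M := (2 * U * V * C + C ^ 2) * μ.real Set.univ with hM
  have hl0 : 0 ≤ l := hl ▸ integral_nonneg fun σ => sq_nonneg _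
  set ρ : ℝ → ℝ := fun t => (1 - C₂ * t) * (1 - Cw * t) with hρ
  have hρlim : Tendsto ρ (𝓝[>] 0) (𝓝 1) := by
    have : Continuous ρ := by fun_prop
    have h := this.tendsto 0
    simp only [hρ, mul_zero, sub_zero, mul_one] at h
    exact h.mono_left nhdsWithin_le_nhds
  -- The summand `t` beside the infimum is slack for a nearly optimal `y`, `M * t` collects the
  -- expansion errors, and `ρ t` bounds `‖K t x‖` from below.
  refine ⟨fun t => 2 * (l * (constrainedInf B m (1 * t ^ (m + 1)) + t) + M * t) / ρ t ^ 2,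
    ?_, ?_⟩
  · have h1 := hc.comp (tendsto_const_mul_pow_nhdsGT one_pos m)
    have h2 := (((h1.add tendsto_id_nhdsGT).const_mul l).add
      (tendsto_id_nhdsGT.const_mul M)).const_mul 2
    have h3 := h2.div (hρlim.pow 2) (by norm_num)
    have e : 2 * (l * (c₀ + 0) + M * 0) / 1 ^ 2 = 2 * (l * c₀) := by ring
    rw [e] at h3
    exact h3
  · have hev1 : ∀ᶠ t in 𝓝[>] (0 : ℝ), C₂ * t < 1 / 2 := by
      have h := (tendsto_id_nhdsGT.const_mul C₂)
      rw [mul_zero] at h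
      exact h.eventually_lt_const (by norm_num)
    have hev2 : ∀ᶠ t in 𝓝[>] (0 : ℝ), Cw * t < 1 / 2 := by
      have h := (tendsto_id_nhdsGT.const_mul Cw)
      rw [mul_zero] at h
      exact h.eventually_lt_const (by norm_num)
    have hev3 : ∀ᶠ t in 𝓝[>] (0 : ℝ), t < 1 :=
      tendsto_id_nhdsGT.eventually_lt_const one_pos
    filter_upwards [hexp, hK, hT, hev1, hev2, hev3, self_mem_nhdsWithin]
      with t hexp hK hT ht1 ht2 ht3 ht0
    replace ht0 : 0 < t := ht0
    obtain ⟨y, hy, hyp, hym⟩ := exists_lt_constrainedInf_add hB hm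
      (show 0 < 1 * t ^ (m + 1) by positivity) ht0
    set x := trialState B w m t y with hx
    have hρ0 : 0 < ρ t := mul_pos (by linarith) (by linarith)
    have hKx : ρ t ≤ ‖K t x‖ := by
      refine le_trans ?_ (one_sub_le_norm_apply hK x)
      have h1 := hCw t ht0 ht3.le y hy
      have h2 := norm_sub_norm_le y (y - x)
      rw [sub_sub_cancel, hy, norm_sub_rev] at h2
      exact mul_le_mul_of_nonneg_left (by linarith) (by linarith)
    have hexp' := hC t ht0 ht3.le (F t) hexp y hy (fun p hp => by simpa using hyp p hp)
    have hv : ‖S ((B ^ m) y)‖ ≤ V := by simpa [hy] using (S * B ^ m).le_opNorm y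
    have hFt := hF t
    have hD := integral_sq_le_of_norm_sub_le μ (f := fun σ => S (F t σ x)) (by fun_prop) huc
      (fun σ => hU 0 (by simp) σ) (by positivity) (by positivity) hexp'
    rw [hl] at hD
    have hD' : ∫ σ, ‖S (F t σ x)‖ ^ 2 ∂μ ≤
        t ^ (2 * m) * (l * (constrainedInf B m (1 * t ^ (m + 1)) + t) + M * t) := by
      refine hD.trans ?_
      have h1 : 2 * t ^ m * U * ‖S ((B ^ m) y)‖ * (C * t ^ (m + 1)) + (C * t ^ (m + 1)) ^ 2
          ≤ (2 * U * V * C + C ^ 2) * (t ^ (2 * m) * t) := by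
        have e1 : 2 * t ^ m * U * ‖S ((B ^ m) y)‖ * (C * t ^ (m + 1)) ≤
          2 * t ^ m * U * V * (C * t ^ (m + 1)) := by gcongr
        have e2 : (C * t ^ (m + 1)) ^ 2 ≤ C ^ 2 * (t ^ (2 * m) * t) := by
          have : (C * t ^ (m + 1)) ^ 2 = C ^ 2 * (t ^ (2 * m) * t) * t := by ring
          rw [this]
          exact mul_le_of_le_one_right (by positivity) ht3.le
        have e3 : 2 * t ^ m * U * V * (C * t ^ (m + 1)) =
          2 * U * V * C * (t ^ (2 * m) * t) := by ring
        linarith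
      have h2 := mul_le_mul_of_nonneg_right h1 (measureReal_nonneg (μ := μ) (s := Set.univ))
      have h3 : (t ^ m) ^ 2 * ‖S ((B ^ m) y)‖ ^ 2 * l ≤
          t ^ (2 * m) * (l * (constrainedInf B m (1 * t ^ (m + 1)) + t)) := by
        rw [← pow_mul, mul_comm m 2, mul_assoc, mul_comm _ l]
        gcongr
      have h4 : (2 * U * V * C + C ^ 2) * (t ^ (2 * m) * t) * μ.real Set.univ =
          t ^ (2 * m) * (M * t) := by
        rw [hM]
        ring
      linarith
    have hTx : (1 - ‖T t‖ ^ 2) * ‖K t x‖ ^ 2 ≤ 2 * t * ∫ σ, ‖S (F t σ x)‖ ^ 2 ∂μ := by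
      have h1 : ‖T t (K t x)‖ ^ 2 ≤ ‖T t‖ ^ 2 * ‖K t x‖ ^ 2 := by
        rw [← mul_pow]
        gcongr
        exact (T t).le_opNorm _
      rw [hT x] at h1
      linarith
    have hD0 : 0 ≤ ∫ σ, ‖S (F t σ x)‖ ^ 2 ∂μ := integral_nonneg fun σ => sq_nonneg _
    rw [div_le_div_iff₀ (by positivity) (by positivity)]
    have h5 : (1 - ‖T t‖ ^ 2) * ρ t ^ 2 ≤ 2 * t * ∫ σ, ‖S (F t σ x)‖ ^ 2 ∂μ := by
      -- Contractivity of `T t` is not assumed, so the sign of `1 - ‖T t‖ ^ 2` has to be split.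
      rcases le_or_gt (1 - ‖T t‖ ^ 2) 0 with hneg | hpos
      · exact (mul_nonpos_of_nonpos_of_nonneg hneg (sq_nonneg _)).trans (by positivity)
      · refine le_trans ?_ hTx
        gcongr
    refine h5.trans ?_
    have h6 := mul_le_mul_of_nonneg_left hD' (show 0 ≤ 2 * t by positivity)
    refine h6.trans_eq ?_
    ring

/-- The orthogonality relations bound the decay of the norm from below. -/
lemma exists_tendsto_lower_bound [Nontrivial H] {B : H →L[ℂ] H}
    {m : ℕ} {c₀ : ℝ} (hc₀ : 0 < c₀) (hc : Tendsto (constrainedInf B m) (𝓝[>] 0) (𝓝 c₀))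
    {a h : ℕ → X → ℝ} (ha : ∀ q, Continuous (a q)) (hh : ∀ q, Continuous (h q))
    (hh0 : ∀ p ≤ m, ∀ q < p, ∫ σ, h p σ * a q σ ∂μ = 0)
    (hh1 : ∀ p ≤ m, ∫ σ, h p σ * a p σ ∂μ = 1) {l : ℝ} (hl0 : 0 < l)
    (hl : l * ∫ σ, h m σ ^ 2 ∂μ = 1)
    {F : ℝ → X → H →L[ℂ] H} (hF : ∀ t, Continuous (F t)) {C₁ : ℝ} (hC₁ : 0 ≤ C₁)
    (hexp : ∀ᶠ t in 𝓝[>] (0 : ℝ), ∀ σ,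
      ‖F t σ - ∑ q ∈ Finset.range (m + 1), (t ^ q * a q σ) • B ^ q‖ ≤ C₁ * t ^ (m + 1))
    {T K : ℝ → H →L[ℂ] H} {C₂ : ℝ} (hC₂ : 0 ≤ C₂)
    (hK : ∀ᶠ t in 𝓝[>] (0 : ℝ), ‖K t - 1‖ ≤ C₂ * t)
    (hsurj : ∀ᶠ t in 𝓝[>] (0 : ℝ), ∀ x, ∃ y, K t y = x)
    (hT : ∀ᶠ t in 𝓝[>] (0 : ℝ), ∀ y, ‖T t (K t y)‖ ^ 2 = ‖K t y‖ ^ 2 -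
      2 * t * ∫ σ, ‖CFC.sqrt (hermPart B) (F t σ y)‖ ^ 2 ∂μ) :
    ∃ g : ℝ → ℝ, Tendsto g (𝓝[>] 0) (𝓝 (2 * (l * c₀))) ∧
      ∀ᶠ t in 𝓝[>] (0 : ℝ), g t ≤ (1 - ‖T t‖ ^ 2) / t ^ (2 * m + 1) := by
  set S := CFC.sqrt (hermPart B) with hS
  have hex : ∀ p : ℕ, ∃ C, 0 ≤ C ∧ (p ≤ m → ∀ t : ℝ, 0 < t → t ≤ 1 →
      ∀ G : X → H →L[ℂ] H, Continuous G →
      (∀ σ, ‖G σ - ∑ q ∈ Finset.range (m + 1), (t ^ q * a q σ) • B ^ q‖ ≤ C₁ * t ^ (m + 1)) →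
      ∀ y : H, t ^ p * ‖S ((B ^ p) y)‖ ≤
        √((∫ σ, h p σ ^ 2 ∂μ) * ∫ σ, ‖S (G σ y)‖ ^ 2 ∂μ) + C * t ^ (p + 1) * ‖y‖) := by
    intro p
    by_cases hp : p ≤ m
    · obtain ⟨C, hC0, hC⟩ := exists_norm_pow_le_sqrt_add μ S B ha (hh p) hp (hh0 p hp)
        (hh1 p hp) hC₁
      exact ⟨C, hC0, fun _ => hC⟩
    · exact ⟨0, le_rfl, fun hp' => absurd hp' hp⟩
  choose C hC0 hC using hex
  set E : ℕ → ℝ := fun p => ∫ σ, h p σ ^ 2 ∂μ with hE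
  have hE0 : ∀ p, 0 ≤ E p := fun p => integral_nonneg fun σ => sq_nonneg _
  -- Any number above the expected limit `l * c₀` would do: vectors dissipating more than `t ^ (2 *
  -- m) * Λ` are harmless, and the others become nearly conservative.
  set Λ := l * c₀ + 1 with hΛ
  have hΛ0 : 0 < Λ := by positivity
  set C₃ := ∑ p ∈ Finset.range (m + 1), (√(E p * Λ) + C p) + 1 with hC₃
  have hC₃le : ∀ p ≤ m, √(E p * Λ) + C p ≤ C₃ := by
    intro p hp
    rw [hC₃]
    refine le_add_of_le_of_nonneg ?_ zero_le_one
    exact Finset.single_le_sum (f := fun p => √(E p * Λ) + C p)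
      (fun p _ => add_nonneg (Real.sqrt_nonneg _) (hC0 p)) (Finset.mem_range.2 (by omega))
  have hC₃0 : 0 < C₃ := by
    have h1 := hC₃le 0 (Nat.zero_le m)
    have : 0 ≤ ∑ p ∈ Finset.range (m + 1), (√(E p * Λ) + C p) :=
      Finset.sum_nonneg fun p _ => add_nonneg (Real.sqrt_nonneg _) (hC0 p)
    rw [hC₃]
    linarith
  set I : ℝ → ℝ := fun t => √(constrainedInf B m (C₃ * t ^ (0 + 1))) with hI
  -- The minimum with `Λ` covers both kinds of vectors, and the positive part allows squaring;
  -- neither changes the limit `l * c₀`.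
  set k : ℝ → ℝ := fun t => min Λ (l * max (I t - C₃ * t) 0 ^ 2) with hk
  have hk0 : ∀ t, 0 ≤ k t := fun t => le_min hΛ0.le (by positivity)
  have hklim : Tendsto k (𝓝[>] 0) (𝓝 (l * c₀)) := by
    have h1 := (hc.comp (tendsto_const_mul_pow_nhdsGT hC₃0 0)).sqrt
    have h2 := (h1.sub (tendsto_id_nhdsGT.const_mul C₃)).max (tendsto_const_nhds (x := (0 : ℝ)))
    have h3 := (tendsto_const_nhds (x := Λ)).min ((h2.pow 2).const_mul l)
    rw [mul_zero, sub_zero, max_eq_left (Real.sqrt_nonneg _), Real.sq_sqrt hc₀.le,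
      min_eq_right (by rw [hΛ]; linarith)] at h3
    exact h3
  have hev3 : ∀ᶠ t in 𝓝[>] (0 : ℝ), t < 1 :=
    tendsto_id_nhdsGT.eventually_lt_const one_pos
  have hev1 : ∀ᶠ t in 𝓝[>] (0 : ℝ), C₂ * t < 1 := by
    have h := (tendsto_id_nhdsGT.const_mul C₂)
    rw [mul_zero] at h
    exact h.eventually_lt_const (by norm_num)
  refine ⟨fun t => 2 * k t / (1 + C₂ * t) ^ 2, ?_, ?_⟩
  · have h1 : Tendsto (fun t : ℝ => (1 + C₂ * t) ^ 2) (𝓝[>] 0) (𝓝 ((1 + C₂ * 0) ^ 2)) :=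
      ((tendsto_id_nhdsGT.const_mul C₂).const_add 1).pow 2
    have h2 := (hklim.const_mul 2).div h1 (by norm_num)
    have e : 2 * (l * c₀) / (1 + C₂ * 0) ^ 2 = 2 * (l * c₀) := by simp
    rw [e] at h2
    exact h2
  filter_upwards [hexp, hK, hT, hsurj, hev1, hev3, self_mem_nhdsWithin]
    with t hexp hK hT hsurj ht1 ht3 ht0
  replace ht0 : 0 < t := ht0
  have hDk : ∀ y : H, ‖y‖ = 1 → t ^ (2 * m) * k t ≤ ∫ σ, ‖S (F t σ y)‖ ^ 2 ∂μ := by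
    intro y hy
    set D := ∫ σ, ‖S (F t σ y)‖ ^ 2 ∂μ with hD
    have hD0 : 0 ≤ D := integral_nonneg fun σ => sq_nonneg _
    rcases le_or_gt (t ^ (2 * m) * Λ) D with hbig | hsmall
    · refine le_trans ?_ hbig
      gcongr
      exact min_le_left _ _
    -- Small dissipation makes `y` admissible for the infimum with tolerance `C₃ * t`.
    · have hp : ∀ p < m, ‖S ((B ^ p) y)‖ ≤ C₃ * t ^ (0 + 1) := by
        intro p hp
        have h1 := hC p hp.le t ht0 ht3.le (F t) (hF t) hexp y
        rw [hy, mul_one] at h1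
        have h2 : √(E p * D) ≤ √(E p * Λ) * t ^ (p + 1) := by
          have h3 : t ^ m ≤ t ^ (p + 1) := pow_le_pow_of_le_one ht0.le ht3.le hp
          calc √(E p * D) ≤ √(E p * (t ^ (2 * m) * Λ)) := by
                have := hE0 p
                gcongr
            _ = √(E p * Λ * (t ^ m) ^ 2) := by congr 1; ring
            _ = √(E p * Λ) * t ^ m := by
              rw [Real.sqrt_mul (mul_nonneg (hE0 p) hΛ0.le), Real.sqrt_sq (by positivity)]
            _ ≤ _ := by gcongr
        have h3 : t ^ p * ‖S ((B ^ p) y)‖ ≤ t ^ p * (C₃ * t ^ (0 + 1)) := by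
          refine (h1.trans (add_le_add_left h2 _)).trans ?_
          have h4 := mul_le_mul_of_nonneg_right (hC₃le p hp.le)
            (show 0 ≤ t ^ (p + 1) by positivity)
          have h5 : t ^ p * (C₃ * t ^ (0 + 1)) = C₃ * t ^ (p + 1) := by ring
          rw [h5]
          linarith
        exact le_of_mul_le_mul_left h3 (by positivity)
      have hIle : I t ≤ ‖S ((B ^ m) y)‖ := by
        rw [hI, Real.sqrt_le_left (norm_nonneg _)]
        exact constrainedInf_le B m hy hp
      have h1 := hC m le_rfl t ht0 ht3.le (F t) (hF t) hexp y
      rw [hy, mul_one] at h1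
      have h2 : C m ≤ C₃ := (le_add_of_nonneg_left (Real.sqrt_nonneg _)).trans (hC₃le m le_rfl)
      have h3 : t ^ m * (I t - C₃ * t) ≤ √(E m * D) := by
        have h4 : t ^ m * I t ≤ t ^ m * ‖S ((B ^ m) y)‖ := by gcongr
        have h5 : C m * t ^ (m + 1) ≤ C₃ * t ^ (m + 1) := by gcongr
        have h6 : t ^ m * (C₃ * t) = C₃ * t ^ (m + 1) := by ring
        rw [mul_sub, h6]
        linarith
      have h4 : t ^ m * max (I t - C₃ * t) 0 ≤ √(E m * D) := by
        rcases max_cases (I t - C₃ * t) 0 with ⟨h, -⟩ | ⟨h, -⟩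
        · rwa [h]
        · rw [h, mul_zero]
          exact Real.sqrt_nonneg _
      have h5 : (t ^ m * max (I t - C₃ * t) 0) ^ 2 ≤ E m * D := by
        rw [← Real.sq_sqrt (mul_nonneg (hE0 m) hD0)]
        exact pow_le_pow_left₀ (by positivity) h4 2
      calc t ^ (2 * m) * k t ≤ t ^ (2 * m) * (l * max (I t - C₃ * t) 0 ^ 2) := by
            gcongr
            exact min_le_right _ _
        _ = l * (t ^ m * max (I t - C₃ * t) 0) ^ 2 := by ring
        _ ≤ l * (E m * D) := by gcongr
        _ = D := by rw [← mul_assoc, hl, one_mul]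
  set r := 2 * k t / (1 + C₂ * t) ^ 2 * t ^ (2 * m + 1) with hr
  have hone : 0 < 1 + C₂ * t := by positivity
  have hunit : ∀ y : H, ‖y‖ = 1 → ‖T t (K t y)‖ ^ 2 ≤ (1 - r) * ‖K t y‖ ^ 2 := by
    intro y hy
    have h1 : ‖K t y‖ ≤ 1 + C₂ * t := by simpa [hy] using norm_apply_le_one_add hK y
    have h2 : r * ‖K t y‖ ^ 2 ≤ 2 * t * ∫ σ, ‖S (F t σ y)‖ ^ 2 ∂μ := by
      have hr0 : 0 ≤ r := by
        have := hk0 t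
        positivity
      calc r * ‖K t y‖ ^ 2 ≤ r * (1 + C₂ * t) ^ 2 := by gcongr
        _ = 2 * t * (t ^ (2 * m) * k t) := by
          rw [hr]
          field_simp
          ring
        _ ≤ _ := by
          gcongr
          exact hDk y hy
    rw [hT y]
    linarith
  have hgen : ∀ x : H, ‖T t x‖ ^ 2 ≤ (1 - r) * ‖x‖ ^ 2 := by
    intro x
    obtain ⟨y, rfl⟩ := hsurj x
    rcases eq_or_ne y 0 with rfl | hy
    · simp
    · have hny : 0 < ‖y‖ := norm_pos_iff.2 hy
      have h1 := hunit ((‖y‖⁻¹ : ℝ) • y) (by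
        rw [norm_smul, Real.norm_of_nonneg (by positivity), inv_mul_cancel₀ hny.ne'])
      simp only [ContinuousLinearMap.map_smul_of_tower, norm_smul, mul_pow] at h1
      have h2 : 0 < ‖(‖y‖⁻¹ : ℝ)‖ ^ 2 := by
        have : ‖y‖⁻¹ ≠ 0 := inv_ne_zero hny.ne'
        positivity
      refine le_of_mul_le_mul_left (h1.trans_eq ?_) h2
      ring
  -- A unit vector in the estimate just proved shows that the square root below is genuine.
  have hr1 : 0 ≤ 1 - r := by
    obtain ⟨x, hx⟩ := exists_norm_eq H zero_le_one
    have h1 := hgen x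
    rw [hx] at h1
    have : 0 ≤ ‖T t x‖ ^ 2 := by positivity
    linarith
  have hN : ‖T t‖ ≤ √(1 - r) := by
    refine ContinuousLinearMap.opNorm_le_bound _ (Real.sqrt_nonneg _) fun x => ?_
    rw [← Real.sqrt_sq (norm_nonneg x), ← Real.sqrt_mul hr1]
    exact Real.le_sqrt_of_sq_le (hgen x)
  have hN2 : ‖T t‖ ^ 2 ≤ 1 - r := by
    rw [← Real.sq_sqrt hr1]
    gcongr
  rw [le_div_iff₀ (by positivity)]
  show r ≤ 1 - ‖T t‖ ^ 2
  linarith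

/-- The short-time expansion of the norm of a family of operators with the given energy balance,
where `h m` is (up to scaling) the component of `a m` orthogonal to all `a q` with `q < m`. -/
theorem norm_sub_isLittleO [Nontrivial H] {B : H →L[ℂ] H} (hB : IsSemiDissipative (-B))
    {m : ℕ} (hm : IsHCIndex B m) {c₀ : ℝ} (hc₀ : 0 < c₀)
    (hc : Tendsto (constrainedInf B m) (𝓝[>] 0) (𝓝 c₀))
    {a h : ℕ → X → ℝ} (ha : ∀ q, Continuous (a q)) (hh : ∀ q, Continuous (h q))
    (hh0 : ∀ p ≤ m, ∀ q < p, ∫ σ, h p σ * a q σ ∂μ = 0)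
    (hh1 : ∀ p ≤ m, ∫ σ, h p σ * a p σ ∂μ = 1)
    {w : ℕ → ℝ} {l : ℝ} (hl0 : 0 < l) (hl : l * ∫ σ, h m σ ^ 2 ∂μ = 1)
    (hw : ∀ σ, ∑ p ∈ Finset.range (m + 1), w p * a p σ = l * h m σ)
    {F : ℝ → X → H →L[ℂ] H} (hF : ∀ t, Continuous (F t)) {C₁ : ℝ} (hC₁ : 0 ≤ C₁)
    (hexp : ∀ᶠ t in 𝓝[>] (0 : ℝ), ∀ σ,
      ‖F t σ - ∑ q ∈ Finset.range (m + 1), (t ^ q * a q σ) • B ^ q‖ ≤ C₁ * t ^ (m + 1))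
    {T K : ℝ → H →L[ℂ] H} {C₂ : ℝ} (hC₂ : 0 ≤ C₂)
    (hK : ∀ᶠ t in 𝓝[>] (0 : ℝ), ‖K t - 1‖ ≤ C₂ * t)
    (hsurj : ∀ᶠ t in 𝓝[>] (0 : ℝ), ∀ x, ∃ y, K t y = x)
    (hT : ∀ᶠ t in 𝓝[>] (0 : ℝ), ∀ y, ‖T t (K t y)‖ ^ 2 = ‖K t y‖ ^ 2 -
      2 * t * ∫ σ, ‖CFC.sqrt (hermPart B) (F t σ y)‖ ^ 2 ∂μ) :
    (fun t => ‖T t‖ - (1 - l * c₀ * t ^ (2 * m + 1))) =o[𝓝[>] 0] fun t => t ^ (2 * m + 1) := by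
  have hl' : ∫ σ, (∑ p ∈ Finset.range (m + 1), w p * a p σ) ^ 2 ∂μ = l := by
    simp only [hw, mul_pow]
    rw [integral_const_mul, sq, mul_assoc, hl, mul_one]
  -- Pairing the combination with `h m` leaves `w m` by orthogonality, and `l * ∫ (h m) ^ 2 = 1` by
  -- its value.
  have hwm : w m = 1 := by
    have h1 : ∫ σ, h m σ * ∑ p ∈ Finset.range (m + 1), w p * a p σ ∂μ = w m := by
      have h2 : ∀ σ, h m σ * ∑ p ∈ Finset.range (m + 1), w p * a p σ =
          ∑ p ∈ Finset.range (m + 1), w p * (h m σ * a p σ) := by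
        intro σ
        rw [Finset.mul_sum]
        exact Finset.sum_congr rfl fun p _ => by ring
      rw [integral_congr_ae (Eventually.of_forall h2), integral_finsetSum _ fun p _ => by
        have := ha p
        have := hh m
        exact integrable_of_continuous μ (by fun_prop)]
      simp only [integral_const_mul]
      rw [Finset.sum_range_succ, hh1 m le_rfl, mul_one, Finset.sum_eq_zero, zero_add]
      intro p hp
      rw [hh0 m le_rfl p (Finset.mem_range.1 hp), mul_zero]
    rw [← h1, ← hl, ← integral_const_mul]
    refine integral_congr_ae (Eventually.of_forall fun σ => ?_)
    simp only [hw]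
    ring
  obtain ⟨g₁, hg₁, hle₁⟩ := exists_tendsto_lower_bound μ hc₀ hc ha hh hh0 hh1 hl0 hl hF hC₁
    hexp hC₂ hK hsurj hT
  obtain ⟨g₂, hg₂, hle₂⟩ := exists_tendsto_upper_bound μ hB hm hc ha hwm hl' hF hC₁
    hexp hK hT
  have hlim : Tendsto (fun t => (1 - ‖T t‖ ^ 2) / t ^ (2 * m + 1)) (𝓝[>] 0)
      (𝓝 (2 * (l * c₀))) := tendsto_of_tendsto_of_tendsto_of_le_of_le' hg₁ hg₂ hle₁ hle₂
  have hpow : Tendsto (fun t : ℝ => t ^ (2 * m + 1)) (𝓝[>] 0) (𝓝 0) := by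
    simpa using tendsto_id_nhdsGT.pow (2 * m + 1)
  have hne : ∀ᶠ t in 𝓝[>] (0 : ℝ), t ^ (2 * m + 1) ≠ 0 :=
    eventually_mem_nhdsWithin.mono fun t ht => pow_ne_zero _ (ne_of_gt ht)
  have hN2 : Tendsto (fun t => ‖T t‖ ^ 2) (𝓝[>] 0) (𝓝 1) := by
    have h1 := (hlim.mul hpow).const_sub 1
    rw [mul_zero, sub_zero] at h1
    refine h1.congr' (hne.mono fun t ht => ?_)
    rw [div_mul_cancel₀ _ ht]
    ring
  have hN1 : Tendsto (fun t => ‖T t‖) (𝓝[>] 0) (𝓝 1) := by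
    simpa [Real.sqrt_sq (norm_nonneg _)] using hN2.sqrt
  rw [isLittleO_iff_tendsto' (hne.mono fun t ht h0 => absurd h0 ht)]
  -- Since `1 - ‖T‖ = (1 - ‖T‖ ^ 2) / (1 + ‖T‖)` and `‖T‖ → 1`, the factor two cancels.
  have h2 := (hlim.div (hN1.const_add 1) (by norm_num)).neg.add_const (l * c₀)
  have h3 : -(2 * (l * c₀) / (1 + 1)) + l * c₀ = 0 := by ring
  rw [h3] at h2
  refine h2.congr' (hne.mono fun t ht => ?_)
  have h4 : 1 + ‖T t‖ ≠ 0 := by positivity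
  simp only [Pi.div_apply]
  field_simp
  ring

end ShortTime

/-! ### Midpoint polynomials and the Cayley expansion -/

open Polynomial in
/-- The polynomials `(1 + X / 2) ^ (m - j) * (1 - X / 2) ^ j` of the implicit midpoint rule. -/
def midpointPoly (m j : ℕ) : ℝ[X] :=
  (1 + C (1 / 2) * X) ^ (m - j) * (1 - C (1 / 2) * X) ^ j

open Polynomial in
lemma natDegree_midpointPoly_lt {m j : ℕ} (hj : j ≤ m) :
    (midpointPoly m j).natDegree < m + 1 := by
  have h1 : (1 + C (1 / 2) * X : ℝ[X]).natDegree ≤ 1 := by compute_degree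
  have h2 : (1 - C (1 / 2) * X : ℝ[X]).natDegree ≤ 1 := by compute_degree
  refine Nat.lt_succ_of_le (natDegree_mul_le.trans ?_)
  have h3 := natDegree_pow_le_of_le (m - j) h1
  have h4 := natDegree_pow_le_of_le j h2
  omega

open Polynomial in
/-- Signed binomial weights turn the midpoint polynomials into multiples of `X ^ p`. -/
lemma sum_choose_mul_midpointPoly {m p : ℕ} (hp : p ≤ m) :
    ∑ j ∈ Finset.range (m + 1), C ((-1 : ℝ) ^ j * (p.choose j : ℝ)) * midpointPoly m j =
      (1 + C (1 / 2) * X) ^ (m - p) * X ^ p := by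
  -- `X` is the difference of the two linear factors, so the binomial theorem for `X ^ p` produces
  -- the weights.
  have hX : (X : ℝ[X]) = -(1 - C (1 / 2) * X) + (1 + C (1 / 2) * X) := by
    have : (C (1 / 2 : ℝ) : ℝ[X]) + C (1 / 2) = 1 := by
      rw [← C_add]
      norm_num
    linear_combination -(X : ℝ[X]) * this
  have hsub : Finset.range (p + 1) ⊆ Finset.range (m + 1) :=
    Finset.range_subset_range.2 (by omega)
  rw [← Finset.sum_subset hsub]
  · have hpow : (X : ℝ[X]) ^ p = (-(1 - C (1 / 2) * X) + (1 + C (1 / 2) * X)) ^ p := by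
      rw [← hX]
    rw [hpow, add_pow (-(1 - C (1 / 2) * X) : ℝ[X]), Finset.mul_sum]
    refine Finset.sum_congr rfl fun j hj => ?_
    have hj' := Finset.mem_range.1 hj
    rw [midpointPoly, neg_pow (1 - C (1 / 2) * X : ℝ[X]) j, show m - j = (m - p) + (p - j) by omega,
      pow_add, C_mul, C_pow, C_neg, C_1, C_eq_natCast]
    ring
  · intro j _ hj
    have : p < j := by
      rw [Finset.mem_range] at hj
      omega
    rw [Nat.choose_eq_zero_of_lt this]
    simp

lemma sum_choose_mul_coeff {m p : ℕ} (hp : p ≤ m) (q : ℕ) :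
    ∑ j ∈ Finset.range (m + 1), (-1 : ℝ) ^ j * (p.choose j : ℝ) * (midpointPoly m j).coeff q =
      ((1 + Polynomial.C (1 / 2) * Polynomial.X : Polynomial ℝ) ^ (m - p) *
        Polynomial.X ^ p).coeff q := by
  rw [← sum_choose_mul_midpointPoly hp, Polynomial.finsetSum_coeff]
  exact Finset.sum_congr rfl fun j _ => by rw [Polynomial.coeff_C_mul]

lemma sum_choose_mul_coeff_of_lt {m p q : ℕ} (hp : p ≤ m) (hq : q < p) :
    ∑ j ∈ Finset.range (m + 1), (-1 : ℝ) ^ j * (p.choose j : ℝ) * (midpointPoly m j).coeff q =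
      0 := by
  rw [sum_choose_mul_coeff hp, Polynomial.coeff_mul_X_pow', if_neg (by omega)]

lemma sum_choose_mul_coeff_self {m p : ℕ} (hp : p ≤ m) :
    ∑ j ∈ Finset.range (m + 1), (-1 : ℝ) ^ j * (p.choose j : ℝ) * (midpointPoly m j).coeff p =
      1 := by
  rw [sum_choose_mul_coeff hp, Polynomial.coeff_mul_X_pow', if_pos le_rfl, Nat.sub_self,
    Polynomial.coeff_zero_eq_eval_zero]
  simp

/-- The coefficient vectors of the midpoint polynomials span. -/
lemma exists_sum_mul_coeff_midpointPoly (m : ℕ) (v : Fin (m + 1) → ℝ) :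
    ∃ w : ℕ → ℝ, ∀ j : Fin (m + 1),
      ∑ p ∈ Finset.range (m + 1), w p * (midpointPoly m j).coeff p = v j := by
  let A : Matrix (Fin (m + 1)) (Fin (m + 1)) ℝ :=
    Matrix.of fun p j => (-1 : ℝ) ^ (j : ℕ) * ((p : ℕ).choose j : ℝ)
  let M : Matrix (Fin (m + 1)) (Fin (m + 1)) ℝ :=
    Matrix.of fun j q => (midpointPoly m j).coeff q
  have hAM : ∀ p q, (A * M) p q = ∑ j ∈ Finset.range (m + 1),
      (-1 : ℝ) ^ j * ((p : ℕ).choose j : ℝ) * (midpointPoly m j).coeff q := by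
    intro p q
    rw [Finset.sum_range]
    rfl
  -- Orthogonality makes the product of weight and coefficient matrices upper unitriangular, so the
  -- coefficient matrix is invertible.
  have hdet : (A * M).det = 1 := by
    rw [Matrix.det_of_isUpperTriangular]
    · refine Finset.prod_eq_one fun p _ => ?_
      rw [hAM, sum_choose_mul_coeff_self (by omega)]
    · intro p q hqp
      have hqp' : (q : ℕ) < p := hqp
      rw [hAM, sum_choose_mul_coeff_of_lt (by omega) hqp']
  have hM : IsUnit M.det := by
    rw [Matrix.det_mul] at hdet
    exact IsUnit.of_mul_eq_one_right _ hdet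
  refine ⟨fun p => if h : p < m + 1 then (M⁻¹.mulVec v) ⟨p, h⟩ else 0, fun j => ?_⟩
  have h1 : M.mulVec (M⁻¹.mulVec v) = v := by
    rw [Matrix.mulVec_mulVec, Matrix.mul_nonsing_inv _ hM, Matrix.one_mulVec]
  have h2 := congrFun h1 j
  rw [← h2, Finset.sum_range]
  simp only [Fin.is_lt, dite_true, Fin.eta]
  exact Finset.sum_congr rfl fun p _ => mul_comm _ _

lemma sum_choose_sq (m : ℕ) :
    ∑ j ∈ Finset.range (m + 1), ((-1 : ℝ) ^ j * (m.choose j : ℝ)) ^ 2 = ((2 * m).choose m : ℝ) := by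
  have h : ∀ j, ((-1 : ℝ) ^ j * (m.choose j : ℝ)) ^ 2 = ((m.choose j ^ 2 : ℕ) : ℝ) := by
    intro j
    rw [mul_pow, ← pow_mul, mul_comm j 2, pow_mul]
    simp
  simp only [h]
  rw [← Nat.cast_sum, Nat.sum_range_choose_sq]

lemma aeval_midpointPoly (B : H →L[ℂ] H) (m j : ℕ) (τ : ℝ) :
    Polynomial.aeval (τ • B) (midpointPoly m j) =
      (1 + (τ / 2) • B) ^ (m - j) * (1 - (τ / 2) • B) ^ j := by
  have h : algebraMap ℝ (H →L[ℂ] H) (1 / 2) * (τ • B) = (τ / 2) • B := by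
    rw [Algebra.algebraMap_eq_smul_one, smul_mul_assoc, one_mul, smul_smul]
    congr 1
    ring
  simp only [midpointPoly, map_mul, map_pow, map_add, map_sub, map_one, Polynomial.aeval_C,
    Polynomial.aeval_X, h]

lemma midpoint_expansion (B : H →L[ℂ] H) {m j : ℕ} (hj : j ≤ m) (τ : ℝ) :
    (1 + (τ / 2) • B) ^ (m - j) * (1 - (τ / 2) • B) ^ j =
      ∑ q ∈ Finset.range (m + 1), (τ ^ q * (midpointPoly m j).coeff q) • B ^ q := by
  rw [← aeval_midpointPoly, Polynomial.aeval_eq_sum_range' (natDegree_midpointPoly_lt hj)]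
  refine Finset.sum_congr rfl fun q _ => ?_
  rw [smul_pow, smul_smul, mul_comm]

lemma exists_norm_one_add_smul_pow_sub_one_le [Nontrivial H] (B : H →L[ℂ] H) (k : ℕ) :
    ∃ C, 0 ≤ C ∧ ∀ t : ℝ, 0 < t → t ≤ 1 → ‖(1 + (t / 2) • B) ^ k - 1‖ ≤ C * t := by
  induction k with
  | zero => exact ⟨0, le_rfl, by simp⟩
  | succ k ih =>
    obtain ⟨C, hC0, hC⟩ := ih
    refine ⟨C * (1 + ‖B‖) + ‖B‖, by positivity, fun t ht0 ht1 => ?_⟩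
    have h0 : ‖(t / 2) • B‖ ≤ t * ‖B‖ := by
      rw [norm_smul, Real.norm_of_nonneg (by positivity)]
      gcongr
      linarith
    have h1 : ‖1 + (t / 2) • B‖ ≤ 1 + ‖B‖ := by
      refine (norm_add_le _ _).trans ?_
      rw [norm_one]
      have : t * ‖B‖ ≤ ‖B‖ := mul_le_of_le_one_left (norm_nonneg _) ht1
      linarith
    have h2 : (1 + (t / 2) • B) ^ (k + 1) - 1 =
        ((1 + (t / 2) • B) ^ k - 1) * (1 + (t / 2) • B) + (t / 2) • B := by
      rw [pow_succ, sub_mul, one_mul]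
      abel
    rw [h2]
    calc ‖((1 + (t / 2) • B) ^ k - 1) * (1 + (t / 2) • B) + (t / 2) • B‖
        ≤ ‖(1 + (t / 2) • B) ^ k - 1‖ * ‖1 + (t / 2) • B‖ + ‖(t / 2) • B‖ :=
          (norm_add_le _ _).trans (add_le_add_left (norm_mul_le _ _) _)
      _ ≤ (C * t) * (1 + ‖B‖) + t * ‖B‖ := by
          have := hC t ht0 ht1
          gcongr
      _ = _ := by ring

/-- The short-time expansion for the power `m + 1` of the scaled Cayley transform. -/
theorem norm_scaledCayley_pow_sub_isLittleO [Nontrivial H] {B : H →L[ℂ] H}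
    (hB : IsSemiDissipative (-B)) {m : ℕ} (hm : IsHCIndex B m) {c₀ : ℝ} (hc₀ : 0 < c₀)
    (hc : Tendsto (constrainedInf B m) (𝓝[>] 0) (𝓝 c₀)) :
    (fun τ : ℝ => ‖scaledCayley τ (-B) ^ (m + 1)‖ -
        (1 - 1 / ((2 * m).choose m : ℝ) * c₀ * τ ^ (2 * m + 1)))
      =o[𝓝[>] 0] fun τ : ℝ => τ ^ (2 * m + 1) := by
  have hchoose : (0 : ℝ) < ((2 * m).choose m : ℝ) := by
    exact_mod_cast Nat.choose_pos (by omega)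
  obtain ⟨C₂, hC₂, hK⟩ := exists_norm_one_add_smul_pow_sub_one_le B (m + 1)
  have hsq : ∫ j : Fin (m + 1), ((-1 : ℝ) ^ (j : ℕ) * (m.choose j : ℝ)) ^ 2
      ∂MeasureTheory.Measure.count = ((2 * m).choose m : ℝ) := by
    rw [MeasureTheory.integral_count, ← sum_choose_sq, Finset.sum_range]
  obtain ⟨w, hw⟩ := exists_sum_mul_coeff_midpointPoly m fun j =>
    1 / ((2 * m).choose m : ℝ) * ((-1 : ℝ) ^ (j : ℕ) * (m.choose j : ℝ))
  -- The midpoint polynomials have degree at most `m`, so the expansion is exact and its remainder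
  -- constant is zero.
  refine norm_sub_isLittleO (X := Fin (m + 1)) MeasureTheory.Measure.count hB hm hc₀ hc
    (a := fun p j => (midpointPoly m j).coeff p)
    (h := fun p j => (-1 : ℝ) ^ (j : ℕ) * (p.choose j : ℝ)) (w := w)
    (F := fun τ j => (1 + (τ / 2) • B) ^ (m - j) * (1 - (τ / 2) • B) ^ (j : ℕ))
    (K := fun τ => (1 + (τ / 2) • B) ^ (m + 1))
    (fun _ => continuous_of_discreteTopology) (fun _ => continuous_of_discreteTopology)
    ?_ ?_ (by positivity) ?_ hw (fun _ => continuous_of_discreteTopology) le_rfl ?_ hC₂ ?_ ?_ ?_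
  · intro p hp q hq
    refine Eq.trans ?_ (sum_choose_mul_coeff_of_lt hp hq)
    rw [MeasureTheory.integral_count, Finset.sum_range]
  · intro p hp
    refine Eq.trans ?_ (sum_choose_mul_coeff_self hp)
    rw [MeasureTheory.integral_count, Finset.sum_range]
  · rw [hsq, one_div, inv_mul_cancel₀ hchoose.ne']
  · refine Eventually.of_forall fun t j => ?_
    rw [midpoint_expansion B (by omega), sub_self, norm_zero, zero_mul]
  · filter_upwards [Ioc_mem_nhdsGT (zero_lt_one' ℝ)] with t ht
    exact hK t ht.1 ht.2
  · filter_upwards [self_mem_nhdsWithin] with t ht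
    have : (0 : ℝ) < t := ht
    exact surjective_one_add_smul_pow hB (by positivity) _
  · filter_upwards [self_mem_nhdsWithin] with t ht y
    have : (0 : ℝ) < t := ht
    rw [norm_scaledCayley_pow_sq hB this.le, MeasureTheory.integral_count, Finset.sum_range]
    rfl

/-! ### Normalised shifted Legendre polynomials on the unit interval -/

section Legendre

open Polynomial MeasureTheory

lemma intervalIntegrable_eval (P : ℝ[X]) (a b : ℝ) :
    IntervalIntegrable (fun x => P.eval x) volume a b :=
  P.continuous.intervalIntegrable a b

lemma integral_eval_derivative (P : ℝ[X]) :
    ∫ x in (0 : ℝ)..1, (derivative P).eval x = P.eval 1 - P.eval 0 :=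
  intervalIntegral.integral_eq_sub_of_hasDerivAt (fun x _ => P.hasDerivAt x)
    (intervalIntegrable_eval _ _ _)

lemma integral_derivative_mul {P : ℝ[X]} (h0 : P.eval 0 = 0) (h1 : P.eval 1 = 0) (Q : ℝ[X]) :
    ∫ x in (0 : ℝ)..1, (derivative P * Q).eval x =
      -∫ x in (0 : ℝ)..1, (P * derivative Q).eval x := by
  have h := integral_eval_derivative (P * Q)
  rw [derivative_mul, eval_mul, eval_mul, h0, h1, zero_mul, zero_mul, sub_zero] at h
  simp only [eval_add] at h
  rw [intervalIntegral.integral_add (intervalIntegrable_eval _ _ _)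
    (intervalIntegrable_eval _ _ _)] at h
  linarith

/-- The Beta integral: `X ^ (a + 1) * (1 - X) ^ (b + 1)` vanishes at both ends, so integrating its
derivative lowers `b` and raises `a`. -/
lemma integral_X_pow_mul_one_sub_X_pow (a b : ℕ) :
    ∫ x in (0 : ℝ)..1, (X ^ a * (1 - X) ^ b : ℝ[X]).eval x =
      (a.factorial : ℝ) * b.factorial / ((a + b + 1).factorial : ℝ) := by
  induction b generalizing a with
  | zero =>
    simp only [pow_zero, mul_one, eval_pow, eval_X, integral_pow, Nat.factorial_zero,
      Nat.cast_one, add_zero, Nat.factorial_succ]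
    have := Nat.cast_ne_zero (R := ℝ).2 (Nat.factorial_ne_zero a)
    push_cast
    field_simp
    simp
  | succ b ih =>
    have h := integral_eval_derivative (X ^ (a + 1) * (1 - X) ^ (b + 1))
    have e : derivative (X ^ (a + 1) * (1 - X) ^ (b + 1) : ℝ[X]) =
        C ((a : ℝ) + 1) * (X ^ a * (1 - X) ^ (b + 1)) -
          C ((b : ℝ) + 1) * (X ^ (a + 1) * (1 - X) ^ b) := by
      simp only [derivative_mul, derivative_pow, derivative_sub,
        derivative_one, derivative_X, Nat.add_sub_cancel, Nat.cast_add, Nat.cast_one]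
      ring
    rw [e] at h
    simp only [eval_sub, eval_C_mul] at h
    rw [intervalIntegral.integral_sub ((intervalIntegrable_eval _ _ _).const_mul _)
      ((intervalIntegrable_eval _ _ _).const_mul _), intervalIntegral.integral_const_mul,
      intervalIntegral.integral_const_mul, ih (a + 1)] at h
    have h' : (X ^ (a + 1) * (1 - X) ^ (b + 1) : ℝ[X]).eval 1 -
      (X ^ (a + 1) * (1 - X) ^ (b + 1) : ℝ[X]).eval 0 = 0 := by simp
    rw [h', show a + 1 + b + 1 = a + (b + 1) + 1 by ring] at h
    have h1 : ((a : ℝ) + 1) ≠ 0 := by positivity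
    refine mul_left_cancel₀ h1 ?_
    rw [sub_eq_zero.1 h, Nat.factorial_succ a, Nat.factorial_succ b]
    push_cast
    ring

/-- `(X (1 - X)) ^ n`, whose `n`-th derivative is a multiple of the shifted Legendre
polynomial. -/
def bumpPoly (n : ℕ) : ℝ[X] := X ^ n * (1 - X) ^ n

/-- The integral of `(x (1 - x)) ^ n` over the unit interval. -/
def bumpMass (n : ℕ) : ℝ := (n.factorial : ℝ) * n.factorial / ((n + n + 1).factorial : ℝ)

lemma bumpMass_pos (n : ℕ) : 0 < bumpMass n := by
  unfold bumpMass
  positivity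

lemma eval_iterate_derivative_bumpPoly {n k : ℕ} (hk : k < n) :
    (derivative^[k] (bumpPoly n)).eval 0 = 0 ∧ (derivative^[k] (bumpPoly n)).eval 1 = 0 := by
  rw [bumpPoly, ← mul_pow]
  obtain ⟨R, hR⟩ := pow_sub_dvd_iterate_derivative_pow (X * (1 - X) : ℝ[X]) n k
  rw [hR]
  have : n - k ≠ 0 := by omega
  simp [this]

/-- Zeros of order `n` at both endpoints remove every boundary term in `k ≤ n` integrations by
parts. -/
lemma integral_iterate_derivative_bumpPoly_mul {n k : ℕ} (hk : k ≤ n) (Q : ℝ[X]) :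
    ∫ x in (0 : ℝ)..1, (derivative^[k] (bumpPoly n) * Q).eval x =
      (-1) ^ k * ∫ x in (0 : ℝ)..1, (bumpPoly n * derivative^[k] Q).eval x := by
  induction k generalizing Q with
  | zero => simp
  | succ k ih =>
    obtain ⟨h0, h1⟩ := eval_iterate_derivative_bumpPoly (show k < n by omega)
    rw [Function.iterate_succ_apply', integral_derivative_mul h0 h1, ih (by omega),
      Function.iterate_succ_apply]
    ring

/-- The `n`-th derivative of `(X (1 - X)) ^ n`, normalised. -/
def legendreWeight (n : ℕ) : ℝ[X] := C (bumpMass n)⁻¹ * derivative^[n] (bumpPoly n)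

lemma integral_legendreWeight_mul (n : ℕ) (Q : ℝ[X]) :
    ∫ x in (0 : ℝ)..1, (legendreWeight n * Q).eval x =
      (bumpMass n)⁻¹ * ((-1) ^ n * ∫ x in (0 : ℝ)..1, (bumpPoly n * derivative^[n] Q).eval x) := by
  rw [← integral_iterate_derivative_bumpPoly_mul le_rfl, ← intervalIntegral.integral_const_mul]
  simp only [legendreWeight, mul_assoc, eval_C_mul]

/-- A constant `n`-th derivative leaves only the mass of the bump, which the normalisation cancels.
Orthogonality, the unit pairing and the norm all follow from this case. -/
lemma integral_legendreWeight_mul_of_iterate_derivative {n : ℕ} {Q : ℝ[X]} {r : ℝ}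
    (hQ : derivative^[n] Q = C r) :
    ∫ x in (0 : ℝ)..1, (legendreWeight n * Q).eval x = (-1) ^ n * r := by
  have h : ∫ x in (0 : ℝ)..1, (bumpPoly n * derivative^[n] Q).eval x = r * bumpMass n := by
    rw [hQ, bumpMass, ← integral_X_pow_mul_one_sub_X_pow, ← intervalIntegral.integral_const_mul]
    simp only [bumpPoly, eval_mul, eval_C, mul_comm r]
  rw [integral_legendreWeight_mul, h]
  have := (bumpMass_pos n).ne'
  field_simp

/-- The Taylor monomials of `exp (-x)`. -/
def expMonomial (q : ℕ) : ℝ[X] := C ((-1) ^ q / (q.factorial : ℝ)) * X ^ q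

lemma integral_legendreWeight_mul_expMonomial_of_lt {p q : ℕ} (hq : q < p) :
    ∫ x in (0 : ℝ)..1, (legendreWeight p * expMonomial q).eval x = 0 := by
  rw [integral_legendreWeight_mul_of_iterate_derivative (r := 0), mul_zero]
  rw [map_zero]
  refine iterate_derivative_eq_zero (lt_of_le_of_lt ?_ hq)
  exact natDegree_C_mul_X_pow_le _ _

lemma integral_legendreWeight_mul_expMonomial_self (p : ℕ) :
    ∫ x in (0 : ℝ)..1, (legendreWeight p * expMonomial p).eval x = 1 := by
  rw [integral_legendreWeight_mul_of_iterate_derivative (r := (-1) ^ p), ← mul_pow]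
  · simp
  · rw [expMonomial, iterate_derivative_C_mul, iterate_derivative_X_pow_eq_smul,
      Nat.descFactorial_self, Nat.sub_self, pow_zero, smul_eq_C_mul, mul_one, ← C_mul]
    congr 1
    have := Nat.cast_ne_zero (R := ℝ).2 (Nat.factorial_ne_zero p)
    field_simp

lemma natDegree_bumpPoly_le (n : ℕ) : (bumpPoly n).natDegree ≤ 2 * n := by
  have h2 : (1 - X : ℝ[X]).natDegree ≤ 1 := by compute_degree
  have h3 := natDegree_pow_le_of_le n h2
  have h4 := natDegree_X_pow_le (R := ℝ) n
  refine natDegree_mul_le.trans ?_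
  omega

lemma coeff_bumpPoly (n : ℕ) : (bumpPoly n).coeff (2 * n) = (-1) ^ n := by
  have h2 : (1 - X : ℝ[X]).natDegree ≤ 1 := by compute_degree
  have h := coeff_pow_of_natDegree_le (m := n) h2
  rw [bumpPoly, mul_comm (X ^ n), show 2 * n = n * 1 + n by ring, coeff_mul_X_pow, h]
  simp [coeff_X, coeff_one]

lemma iterate_derivative_bumpPoly (n : ℕ) :
    derivative^[2 * n] (bumpPoly n) = C ((-1) ^ n * ((2 * n).factorial : ℝ)) := by
  have h : (derivative^[2 * n] (bumpPoly n)).natDegree ≤ 0 :=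
    (natDegree_iterate_derivative _ _).trans (by have := natDegree_bumpPoly_le n; omega)
  rw [eq_C_of_natDegree_le_zero h, coeff_iterate_derivative, zero_add, coeff_bumpPoly,
    Nat.descFactorial_self, nsmul_eq_mul, mul_comm]

/-- The weight has degree at most `n`, so it can be paired with itself; the value is `(2n)! /
bumpMass n`. -/
lemma integral_legendreWeight_sq (n : ℕ) :
    ∫ x in (0 : ℝ)..1, (legendreWeight n).eval x ^ 2 =
      ((2 * n + 1).factorial : ℝ) * ((2 * n).choose n : ℝ) := by
  have h1 : derivative^[n] (legendreWeight n) =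
      C ((bumpMass n)⁻¹ * ((-1) ^ n * ((2 * n).factorial : ℝ))) := by
    rw [legendreWeight, iterate_derivative_C_mul, ← Function.iterate_add_apply, ← two_mul,
      iterate_derivative_bumpPoly, ← C_mul]
  have h2 := integral_legendreWeight_mul_of_iterate_derivative h1
  have h0 : ∀ x, (legendreWeight n).eval x ^ 2 = (legendreWeight n * legendreWeight n).eval x :=
    fun x => by rw [eval_mul, sq]
  have h3 : ((-1 : ℝ) ^ n) * (-1) ^ n = 1 := by rw [← mul_pow]; simp
  have h4 : ((2 * n).choose n : ℝ) * (n.factorial * n.factorial) = (2 * n).factorial := by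
    have := Nat.choose_mul_factorial_mul_factorial (show n ≤ 2 * n by omega)
    rw [show 2 * n - n = n by omega] at this
    rw [← mul_assoc]
    exact_mod_cast this
  simp only [h0]
  rw [h2, bumpMass, ← two_mul n, ← h4]
  have := Nat.cast_ne_zero (R := ℝ).2 (Nat.factorial_ne_zero n)
  field_simp
  linear_combination ((2 * n).choose n : ℝ) * h3

/-- A degree bound suffices: `w` rescales the coefficients to undo the Taylor factors `(-1) ^ p /
p!`. -/
lemma exists_sum_mul_expMonomial (n : ℕ) :
    ∃ w : ℕ → ℝ, ∀ x : ℝ, ∑ p ∈ Finset.range (n + 1), w p * (expMonomial p).eval x =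
      1 / (((2 * n + 1).factorial : ℝ) * ((2 * n).choose n : ℝ)) * (legendreWeight n).eval x := by
  set l : ℝ := 1 / (((2 * n + 1).factorial : ℝ) * ((2 * n).choose n : ℝ))
  have hdeg : (legendreWeight n).natDegree < n + 1 := by
    refine Nat.lt_succ_of_le ((natDegree_C_mul_le _ _).trans
      ((natDegree_iterate_derivative _ _).trans ?_))
    have := natDegree_bumpPoly_le n
    omega
  refine ⟨fun p => l * (legendreWeight n).coeff p * ((-1) ^ p * (p.factorial : ℝ)), fun x => ?_⟩
  rw [eval_eq_sum_range' hdeg, Finset.mul_sum]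
  refine Finset.sum_congr rfl fun p _ => ?_
  have h3 : ((-1 : ℝ) ^ p) * (-1) ^ p = 1 := by rw [← mul_pow]; simp
  have := Nat.cast_ne_zero (R := ℝ).2 (Nat.factorial_ne_zero p)
  simp only [expMonomial, eval_mul, eval_C, eval_pow, eval_X]
  field_simp
  linear_combination l * (legendreWeight n).coeff p * x ^ p * h3

end Legendre

/-! ### Energy balance and expansion of the propagator -/

section Exponential

open MeasureTheory

lemma integral_unitInterval (f : ℝ → ℝ) :
    ∫ σ : unitInterval, f σ = ∫ x in (0 : ℝ)..1, f x := by
  rw [unitInterval.measurePreserving_coe.integral_comp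
    (MeasurableEmbedding.subtype_coe measurableSet_Icc) f,
    intervalIntegral.integral_of_le zero_le_one, ← integral_Icc_eq_integral_Ioc]

lemma hasDerivAt_norm_exp_sq {B : H →L[ℂ] H} (hB : IsSemiDissipative (-B)) (y : H) (s : ℝ) :
    HasDerivAt (fun s : ℝ => ‖NormedSpace.exp (-(s • B)) y‖ ^ 2)
      (-2 * ‖CFC.sqrt (hermPart B) (NormedSpace.exp (-(s • B)) y)‖ ^ 2) s := by
  set e : ℝ → H := fun s => NormedSpace.exp (s • (-B)) y with he
  have h1 : HasDerivAt e (((-B) * NormedSpace.exp (s • (-B))) y) s :=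
    ((ContinuousLinearMap.apply ℂ H y).restrictScalars ℝ).hasFDerivAt.comp_hasDerivAt s
      (hasDerivAt_exp_smul_const' (𝕂 := ℝ) (-B) s)
  have h2 := Complex.reCLM.hasFDerivAt.comp_hasDerivAt s (h1.inner ℂ h1)
  have h3 : (fun s : ℝ => ‖NormedSpace.exp (-(s • B)) y‖ ^ 2) =
      Complex.reCLM ∘ fun s => inner ℂ (e s) (e s) := by
    funext s
    rw [Function.comp_apply, he]
    simp only [smul_neg]
    exact (inner_self_eq_norm_sq (𝕜 := ℂ) _).symm
  rw [h3]
  refine h2.congr_deriv ?_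
  have h4 : ((-B) * NormedSpace.exp (s • (-B))) y = -B (e s) := rfl
  rw [h4, map_add, inner_neg_right, inner_neg_left, ← re_inner_self_eq hB]
  simp only [Complex.reCLM_apply, Complex.neg_re]
  rw [← inner_conj_symm (e s) (B (e s)), Complex.conj_re]
  have h5 : NormedSpace.exp (-(s • B)) y = e s := by
    rw [he]
    simp only [smul_neg]
  rw [h5]
  ring

lemma continuous_exp_neg_smul (B : H →L[ℂ] H) :
    Continuous fun s : ℝ => NormedSpace.exp (-(s • B)) := by
  simp only [← smul_neg]
  exact continuous_iff_continuousAt.2 fun s =>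
    (hasDerivAt_exp_smul_const (𝕂 := ℝ) (-B) s).continuousAt

/-- The dissipation rate is integrated over `[0, t]` and rescaled by `s = t * σ`, so that the
parameter space does not depend on `t`. -/
lemma norm_exp_apply_sq {B : H →L[ℂ] H} (hB : IsSemiDissipative (-B)) (y : H) (t : ℝ) :
    ‖NormedSpace.exp (-(t • B)) y‖ ^ 2 = ‖y‖ ^ 2 - 2 * t *
      ∫ σ : unitInterval,
        ‖CFC.sqrt (hermPart B) (NormedSpace.exp (-((t * (σ : ℝ)) • B)) y)‖ ^ 2 := by
  have hc := continuous_exp_neg_smul B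
  have h1 := intervalIntegral.integral_eq_sub_of_hasDerivAt (a := 0) (b := t)
    (fun s _ => hasDerivAt_norm_exp_sq hB y s)
    (Continuous.intervalIntegrable (by fun_prop) _ _)
  rw [intervalIntegral.integral_const_mul] at h1
  have h2 := intervalIntegral.smul_integral_comp_mul_left (a := 0) (b := 1)
    (fun s => ‖CFC.sqrt (hermPart B) (NormedSpace.exp (-(s • B)) y)‖ ^ 2) t
  rw [mul_zero, mul_one, smul_eq_mul] at h2
  rw [integral_unitInterval
    (fun x => ‖CFC.sqrt (hermPart B) (NormedSpace.exp (-((t * x) • B)) y)‖ ^ 2), mul_assoc, h2]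
  simp only [zero_smul, neg_zero, NormedSpace.exp_zero, one_apply_eq_self] at h1
  linarith

/-- The Taylor remainder is uniform in `σ` because `‖(t * σ) • B‖ ≤ t * ‖B‖`. -/
lemma exists_exp_remainder_le (B : H →L[ℂ] H) (m : ℕ) :
    ∃ C, 0 ≤ C ∧ ∀ᶠ t in 𝓝[>] (0 : ℝ), ∀ σ : unitInterval,
      ‖NormedSpace.exp (-((t * (σ : ℝ)) • B)) - ∑ q ∈ Finset.range (m + 1),
        (t ^ q * (expMonomial q).eval (σ : ℝ)) • B ^ q‖ ≤ C * t ^ (m + 1) := by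
  have h := (NormedSpace.exp_hasFPowerSeriesAt_zero (𝕂 := ℝ)
    (𝔸 := H →L[ℂ] H)).isBigO_sub_partialSum_pow (m + 1)
  obtain ⟨C, hC0, hC⟩ := h.exists_nonneg
  rw [IsBigOWith, Metric.eventually_nhds_iff] at hC
  obtain ⟨ε, hε, hC⟩ := hC
  have hlim := tendsto_id_nhdsGT.mul_const ‖B‖
  rw [zero_mul] at hlim
  refine ⟨C * ‖B‖ ^ (m + 1), by positivity, ?_⟩
  filter_upwards [hlim.eventually_lt_const hε, self_mem_nhdsWithin] with t ht ht0 σ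
  replace ht0 : 0 < t := ht0
  have hn : ‖-((t * (σ : ℝ)) • B)‖ ≤ t * ‖B‖ := by
    rw [norm_neg, norm_smul, norm_mul, Real.norm_of_nonneg ht0.le, Real.norm_of_nonneg σ.2.1]
    have := σ.2.2
    gcongr
    exact mul_le_of_le_one_right ht0.le this
  have h1 := hC (y := -((t * (σ : ℝ)) • B)) (by
    rw [dist_zero_right]
    exact hn.trans_lt ht)
  have h2 : (NormedSpace.expSeries ℝ (H →L[ℂ] H)).partialSum (m + 1) (-((t * (σ : ℝ)) • B)) =
      ∑ q ∈ Finset.range (m + 1), (t ^ q * (expMonomial q).eval (σ : ℝ)) • B ^ q := by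
    rw [FormalMultilinearSeries.partialSum]
    refine Finset.sum_congr rfl fun q _ => ?_
    rw [NormedSpace.expSeries_apply_eq, ← neg_smul, smul_pow, smul_smul, neg_pow, mul_pow]
    simp only [expMonomial, Polynomial.eval_mul, Polynomial.eval_C, Polynomial.eval_pow,
      Polynomial.eval_X]
    congr 1
    ring
  rw [h2, zero_add, norm_pow, norm_norm] at h1
  refine h1.trans ?_
  rw [mul_assoc, ← mul_pow, mul_comm ‖B‖]
  gcongr

/-- The short-time expansion of the propagator norm. -/
theorem propagatorNorm_sub_isLittleO [Nontrivial H] {B : H →L[ℂ] H}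
    (hB : IsSemiDissipative (-B)) {m : ℕ} (hm : IsHCIndex B m) {c₀ : ℝ} (hc₀ : 0 < c₀)
    (hc : Tendsto (constrainedInf B m) (𝓝[>] 0) (𝓝 c₀)) :
    (fun t : ℝ => propagatorNorm B t - (1 - 1 / (((2 * m + 1).factorial : ℝ) *
        ((2 * m).choose m : ℝ)) * c₀ * t ^ (2 * m + 1)))
      =o[𝓝[>] 0] fun t : ℝ => t ^ (2 * m + 1) := by
  have hchoose : (0 : ℝ) < ((2 * m).choose m : ℝ) := by
    exact_mod_cast Nat.choose_pos (by omega)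
  obtain ⟨C₁, hC₁, hexp⟩ := exists_exp_remainder_le B m
  obtain ⟨w, hw⟩ := exists_sum_mul_expMonomial m
  have hcont := continuous_exp_neg_smul B
  refine norm_sub_isLittleO (X := unitInterval) volume hB hm hc₀ hc
    (a := fun p σ => (expMonomial p).eval (σ : ℝ))
    (h := fun p σ => (legendreWeight p).eval (σ : ℝ)) (w := w)
    (F := fun t σ => NormedSpace.exp (-((t * (σ : ℝ)) • B)))
    (T := fun t => NormedSpace.exp (-(t • B))) (K := fun _ => 1) (C₂ := 0)
    (fun p => (expMonomial p).continuous.comp continuous_subtype_val)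
    (fun p => (legendreWeight p).continuous.comp continuous_subtype_val)
    ?_ ?_ (by positivity) ?_ (fun σ => hw σ) (fun t => ?_) hC₁ hexp le_rfl ?_ ?_ ?_
  · intro p _ q hq
    rw [← integral_legendreWeight_mul_expMonomial_of_lt hq, ← integral_unitInterval]
    simp only [Polynomial.eval_mul]
  · intro p _
    rw [← integral_legendreWeight_mul_expMonomial_self p, ← integral_unitInterval]
    simp only [Polynomial.eval_mul]
  · rw [integral_unitInterval fun x => (legendreWeight m).eval x ^ 2, integral_legendreWeight_sq,
      one_div, inv_mul_cancel₀ (by positivity)]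
  · exact hcont.comp (by fun_prop)
  · exact Eventually.of_forall fun t => by simp
  · exact Eventually.of_forall fun t x => ⟨x, rfl⟩
  · exact Eventually.of_forall fun t y => norm_exp_apply_sq hB y t

end Exponential

/-! ### Peano derivatives and the main theorem -/

/-- A function equal to `1 + r t ^ n` up to `o(t ^ n)` has the corresponding Peano derivatives. -/
lemma hasPeanoDeriv_of_isLittleO {f : ℝ → ℝ} {n : ℕ} (hn : n ≠ 0) (h0 : f 0 = 1) {r : ℝ}
    (h : (fun t : ℝ => f t - (1 + r * t ^ n)) =o[𝓝[>] 0] fun t : ℝ => t ^ n) :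
    HasPeanoDeriv n f 0 ((n.factorial : ℝ) * r) := by
  refine ⟨fun j => if j = 0 then 1 else if j = n then (n.factorial : ℝ) * r else 0, by simp [h0],
    by simp [hn], ?_⟩
  refine h.congr_left fun t => ?_
  have hfac := Nat.cast_ne_zero (R := ℝ).2 (Nat.factorial_ne_zero n)
  obtain ⟨k, rfl⟩ := Nat.exists_eq_succ_of_ne_zero hn
  rw [zero_add, Finset.sum_range_succ, Finset.sum_range_succ', Finset.sum_eq_zero]
  · simp only [Nat.succ_eq_add_one, Nat.add_one_ne_zero, if_true, if_false, Nat.factorial_zero,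
      Nat.cast_one, pow_zero] at hfac ⊢
    field_simp
    ring
  · intro j hj
    have hj' := Finset.mem_range.1 hj
    beta_reduce
    rw [if_neg (by omega), if_neg (by omega), zero_div, zero_mul]

/-- For `j < n` both `r * t ^ n` and the error are `o(t ^ j)`, leaving only the constant one. -/
lemma hasPeanoDeriv_of_isLittleO_of_lt {f : ℝ → ℝ} {n j : ℕ} (hj : j < n) (h0 : f 0 = 1) {r : ℝ}
    (h : (fun t : ℝ => f t - (1 + r * t ^ n)) =o[𝓝[>] 0] fun t : ℝ => t ^ n) :
    HasPeanoDeriv j f 0 (if j = 0 then 1 else 0) := by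
  refine ⟨fun j => if j = 0 then 1 else 0, by simp [h0], rfl, ?_⟩
  have h1 : (fun t : ℝ => t ^ n) =o[𝓝[>] 0] fun t : ℝ => t ^ j :=
    (isLittleO_pow_pow hj).mono nhdsWithin_le_nhds
  refine ((h.trans h1).add (h1.const_mul_left r)).congr_left fun t => ?_
  rw [zero_add, Finset.sum_range_succ', Finset.sum_eq_zero]
  · simp
    ring
  · intro i _
    simp

lemma propagatorNorm_zero [Nontrivial H] (B : H →L[ℂ] H) : propagatorNorm B 0 = 1 := by
  rw [propagatorNorm, zero_smul, neg_zero, NormedSpace.exp_zero, norm_one]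

lemma tendsto_sub_one_div_of_isLittleO {f : ℝ → ℝ} {n : ℕ} {r : ℝ}
    (h : (fun t : ℝ => f t - (1 - r * t ^ n)) =o[𝓝[>] 0] fun t : ℝ => t ^ n) :
    Tendsto (fun t : ℝ => (f t - 1) / t ^ n) (𝓝[>] 0) (𝓝 (-r)) := by
  have hne : ∀ᶠ t in 𝓝[>] (0 : ℝ), t ^ n ≠ 0 :=
    eventually_mem_nhdsWithin.mono fun t ht => pow_ne_zero _ (ne_of_gt ht)
  have h1 := (h.tendsto_div_nhds_zero).add_const (-r)
  rw [zero_add] at h1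
  refine h1.congr' (hne.mono fun t ht => ?_)
  field_simp
  ring

end Hypocoercivity

end

theorem mainTheorem3 {H : Type*} [NormedAddCommGroup H] [InnerProductSpace ℂ H]
    [CompleteSpace H] [Nontrivial H] (B : H →L[ℂ] H) (hB : IsSemiDissipative (-B))
    (m : ℕ) (hm : IsHCIndex B m) :
    -- the scaled Cayley transforms are well defined
    (∀ τ : ℝ, 0 < τ → IsUnit (1 - (τ / 2) • (-B))) ∧
    ∃ c : ℝ, 0 < c ∧
      -- the formula for `c`
      Tendsto (fun δ : ℝ =>
          1 / (((2 * m + 1).factorial : ℝ) * ((2 * m).choose m : ℝ)) * constrainedInf B m δ)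
        (𝓝[>] 0) (𝓝 c) ∧
      -- `c` is the constant of the continuous-time expansion
      ((fun t : ℝ => propagatorNorm B t - (1 - c * t ^ (2 * m + 1)))
        =o[𝓝[>] 0] fun t : ℝ => t ^ (2 * m + 1)) ∧
      -- the expansion of the norm of the power `m + 1` of the scaled Cayley transform
      ((fun τ : ℝ => ‖scaledCayley τ (-B) ^ (m + 1)‖ -
          (1 - ((2 * m + 1).factorial : ℝ) * c * τ ^ (2 * m + 1)))
        =o[𝓝[>] 0] fun τ : ℝ => τ ^ (2 * m + 1)) ∧
      -- the symmetric finite difference of order `2m + 1`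
      (∀ τ : ℝ, 0 < τ →
        centralDiff (2 * m + 1) (gridNorm B τ) 0 = gridNorm B τ ((m : ℤ) + 1) - 1) ∧
      Tendsto (fun τ : ℝ => centralDiff (2 * m + 1) (gridNorm B τ) 0 / τ ^ (2 * m + 1))
        (𝓝[>] 0) (𝓝 (-((2 * m + 1).factorial : ℝ) * c)) ∧
      HasPeanoDeriv (2 * m + 1) (propagatorNorm B) 0 (-((2 * m + 1).factorial : ℝ) * c) ∧
      -- the finite differences and Peano derivatives of lower order
      ∀ j : ℕ, j ≤ 2 * m →
        (∀ τ : ℝ, 0 < τ → centralDiff j (gridNorm B τ) 0 = if j = 0 then 1 else 0) ∧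
        HasPeanoDeriv j (propagatorNorm B) 0 (if j = 0 then 1 else 0) := by
  obtain ⟨c₀, hc₀, hlim⟩ := exists_tendsto_constrainedInf hB hm
  have hchoose : (0 : ℝ) < ((2 * m).choose m : ℝ) := by
    exact_mod_cast Nat.choose_pos (by omega)
  set c : ℝ := 1 / (((2 * m + 1).factorial : ℝ) * ((2 * m).choose m : ℝ)) * c₀ with hc
  have hprop := propagatorNorm_sub_isLittleO hB hm hc₀ hlim
  rw [← hc] at hprop
  have hcay := norm_scaledCayley_pow_sub_isLittleO hB hm hc₀ hlim
  have hcc : 1 / ((2 * m).choose m : ℝ) * c₀ = ((2 * m + 1).factorial : ℝ) * c := by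
    rw [hc]
    field_simp
  rw [hcc] at hcay
  have hpeano : (fun t : ℝ => propagatorNorm B t - (1 + (-c) * t ^ (2 * m + 1)))
      =o[𝓝[>] 0] fun t : ℝ => t ^ (2 * m + 1) := by
    simpa only [neg_mul, ← sub_eq_add_neg] using hprop
  refine ⟨fun τ hτ => ?_, c, by positivity, hlim.const_mul _, hprop, hcay,
    fun τ hτ => centralDiff_gridNorm_odd hB hm hτ, ?_, ?_, fun j hj =>
    ⟨fun τ hτ => centralDiff_gridNorm_of_le hB hm hτ hj, ?_⟩⟩
  · rw [smul_neg, sub_neg_eq_add]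
    exact isUnit_one_add_smul hB (by positivity)
  · have h1 := tendsto_sub_one_div_of_isLittleO hcay
    rw [← neg_mul] at h1
    refine h1.congr' ?_
    filter_upwards [self_mem_nhdsWithin] with τ hτ
    rw [centralDiff_gridNorm_odd hB hm hτ, gridNorm, if_pos (by omega)]
    rfl
  · have h1 := hasPeanoDeriv_of_isLittleO (by omega) (propagatorNorm_zero B) hpeano
    rwa [mul_neg, ← neg_mul] at h1
  · exact hasPeanoDeriv_of_isLittleO_of_lt (by omega) (propagatorNorm_zero B) hpeano
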